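/- All functions are on $\mathbb{R}^3$, derivatives are taken in the sense of distributions, and $W_1=\{\psi\in H^1(\mathbb{R}^3;\mathbb{C}) : \|\psi\|_{L^2}=1\}$. For a real potential $v\in L^1_{\mathrm{loc}}(\mathbb{R}^3)$ let $\mathcal{E}_v(\psi)=\int|\nabla\psi|^2+\int v|\psi|^2\in[-\infty,\infty]$ and let $e_0(v)$ be the infimum of $\mathcal{E}_v$ over those $\psi\in W_1$ for which $\int v_+|\psi|^2$ and $\int v_-|\psi|^2$ are not both infinite. A function $\psi\in W_1$ is called the ground state of $-\Delta+v$ if $e_0(v)$ is finite, $\int |v||\psi|^2<\infty$, $\mathcal{E}_v(\psi)=e_0(v)$, $-\Delta\psi+v\psi=e_0(v)\psi$, and $\psi$ is non-degenerate: every minimizer of $\mathcal{E}_v$, and every solution $\varphi\in H^1$ of $-\Delta\varphi+v\varphi=e_0(v)\varphi$ with $\int|v||\varphi|^2<\infty$, is a constant multiple of $\psi$. A density $\rho$ is called ($1$-electron) $v$-representable if $\rho=|\psi|^2$ a.e. for the ground state $\psi$ of $-\Delta+v$ for some $v\in L^1_{\mathrm{loc}}$. Let $\rho\ge 0$ with $\int\rho=1$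 and $\rho^{1/2}\in H^1(\mathbb{R}^3)$, and let $\psi_0$ minimize $\int|\nabla\psi|^2$ over all $\psi\in W_1$ with $\psi\ge0$ and $\psi^2=\rho$. Assume that $\psi_0\neq0$ a.e., that $\phi_0:=\Delta\psi_0\in L^2(\mathbb{R}^3)$, that $\phi_0\le C\rho^{1/2}$ a.e. for some constant $C$, and that $\rho^{-1}\in L^1_{\mathrm{loc}}(\mathbb{R}^3)$. Then $\psi_0=\rho^{1/2}$ a.e., and for every $e\in\mathbb{R}$, with $v=\phi_0/\rho^{1/2}+e$, the function $\psi_0$ is the ground state of $-\Delta+v$, with ground-state energy $e_0(v)=e$. Consequently, if $\rho\ge0$, $\int\rho=1$, $\rho^{1/2}\in H^1(\mathbb{R}^3)$, and (i) $\rho>0$ a.e., (ii) $\Delta\rho^{1/2}\in L^2(\mathbb{R}^3)$ and $\Delta\rho^{1/2}\le C\rho^{1/2}$ a.e. for some constant $C$, and (iii) $\rho^{-1}\in L^1_{\mathrm{loc}}(\mathbb{R}^3)$, then $\rho$ is $v$-representable. -/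

import Mathlib

open MeasureTheory
open scoped ContDiff ENNReal Laplacian

noncomputable section

namespace OneElectron

/-- Physical space `ℝ³` with the Euclidean norm and Lebesgue measure. -/
abbrev R3 : Type := EuclideanSpace ℝ (Fin 3)

/-- Real test functions on `ℝ³`: smooth with compact support. -/
def IsTest (η : R3 → ℝ) : Prop := ContDiff ℝ ∞ η ∧ HasCompactSupport η

/-- The partial derivative of `η` in the `i`-th coordinate direction. -/
def partialDeriv (i : Fin 3) (η : R3 → ℝ) (x : R3) : ℝ :=
  fderiv ℝ η x (EuclideanSpace.single i 1)

/-- `g` is the weak (distributional) gradient of `ψ`, both locally integrable. -/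
structure HasWeakGradient (ψ : R3 → ℂ) (g : R3 → EuclideanSpace ℂ (Fin 3)) : Prop where
  locallyIntegrable : LocallyIntegrable ψ
  locallyIntegrable_grad : LocallyIntegrable g
  integral_eq : ∀ η : R3 → ℝ, IsTest η → ∀ i : Fin 3,
    ∫ x, partialDeriv i η x • ψ x = -∫ x, η x • g x i

/-- `f` is the weak (distributional) Laplacian of the real function `u`,
both locally integrable. -/
structure HasWeakLaplacian (u f : R3 → ℝ) : Prop where
  locallyIntegrable : LocallyIntegrable u
  locallyIntegrable_laplacian : LocallyIntegrable f
  integral_eq : ∀ η : R3 → ℝ, IsTest η → ∫ x, (Δ η) x * u x = ∫ x, η x * f x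

/-- The Sobolev space `H¹(ℝ³)`. -/
def MemH1 (ψ : R3 → ℂ) : Prop :=
  MemLp ψ 2 ∧ ∃ g, HasWeakGradient ψ g ∧ MemLp g 2

open scoped Classical in
/-- The weak gradient of `ψ` (unique up to null sets), and `0` if `ψ` has none. -/
def weakGrad (ψ : R3 → ℂ) : R3 → EuclideanSpace ℂ (Fin 3) :=
  if h : ∃ g, HasWeakGradient ψ g then h.choose else 0

/-- The kinetic energy `∫ |∇ψ|²`. -/
def kinetic (ψ : R3 → ℂ) : ℝ≥0∞ := ∫⁻ x, ‖weakGrad ψ x‖ₑ ^ 2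

/-- The proper one-electron wave functions `W₁`: `ψ ∈ H¹(ℝ³)` with `∫ |ψ|² = 1`
(antisymmetry is void for one electron). -/
def MemW (ψ : R3 → ℂ) : Prop := MemH1 ψ ∧ ∫ x, ‖ψ x‖ ^ 2 = 1

/-- A real function regarded as a complex wave function. -/
def toC (u : R3 → ℝ) : R3 → ℂ := fun x => (u x : ℂ)

/-- The one-electron `N`-representable densities `I₁`:
`ρ ≥ 0`, `∫ ρ = 1`, `ρ^{1/2} ∈ H¹(ℝ³)`. -/
structure MemI (ρ : R3 → ℝ) : Prop where
  nonneg : ∀ᵐ x, 0 ≤ ρ x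
  integrable : Integrable ρ
  integral_eq_one : ∫ x, ρ x = 1
  sqrt_memH1 : MemH1 (toC fun x => √(ρ x))

/-- `u` belongs to the constraint set `{ψ ∈ W₁ | ψ ≥ 0, ψ² = ρ}`. -/
structure IsAdmissible (ρ u : R3 → ℝ) : Prop where
  memW : MemW (toC u)
  nonneg : ∀ᵐ x, 0 ≤ u x
  sq_eq : ∀ᵐ x, u x ^ 2 = ρ x

/-- `ψ₀` minimizes `∫ |∇ψ|²` over `{ψ ∈ W₁ | ψ ≥ 0, ψ² = ρ}`. -/
def IsMinimizer (ρ ψ₀ : R3 → ℝ) : Prop :=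
  IsAdmissible ρ ψ₀ ∧ ∀ u : R3 → ℝ, IsAdmissible ρ u → kinetic (toC ψ₀) ≤ kinetic (toC u)

/-- `∫ v₊ |ψ|²`. -/
def potentialPos (v : R3 → ℝ) (ψ : R3 → ℂ) : ℝ≥0∞ :=
  ∫⁻ x, ENNReal.ofReal (v x) * ‖ψ x‖ₑ ^ 2

/-- `∫ v₋ |ψ|²`. -/
def potentialNeg (v : R3 → ℝ) (ψ : R3 → ℂ) : ℝ≥0∞ :=
  ∫⁻ x, ENNReal.ofReal (-v x) * ‖ψ x‖ₑ ^ 2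

/-- The wave functions in `W₁` whose energy `∫ |∇ψ|² + ∫ v |ψ|²` is defined in `[-∞, ∞]`:
the positive and the negative part of the potential energy are not both infinite. -/
def HasEnergy (v : R3 → ℝ) (ψ : R3 → ℂ) : Prop :=
  MemW ψ ∧ (potentialPos v ψ ≠ ⊤ ∨ potentialNeg v ψ ≠ ⊤)

/-- The energy `∫ |∇ψ|² + ∫ v |ψ|²` of `-Δ + v` in the state `ψ`, as an extended real. -/
def energy (v : R3 → ℝ) (ψ : R3 → ℂ) : EReal :=
  (kinetic ψ : EReal) + ((potentialPos v ψ : EReal) - (potentialNeg v ψ : EReal))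

/-- The ground-state energy `e₀(v)`: the infimum of the energy over `W₁`. -/
def groundEnergy (v : R3 → ℝ) : EReal :=
  ⨅ (ψ : R3 → ℂ) (_ : HasEnergy v ψ), energy v ψ

/-- `ψ ∈ H¹(ℝ³)`, with `∫ |v| |ψ|² < ∞`, solves `-Δψ + v ψ = E ψ` in the sense of
distributions. -/
structure IsEigenfunction (v : R3 → ℝ) (E : ℝ) (ψ : R3 → ℂ) : Prop where
  memH1 : MemH1 ψ
  integrable_potential : Integrable fun x => v x * ‖ψ x‖ ^ 2
  locallyIntegrable : LocallyIntegrable fun x => v x • ψ x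
  integral_eq : ∀ η : R3 → ℝ, IsTest η →
    -(∫ x, (Δ η) x • ψ x) + ∫ x, η x • (v x • ψ x) = E • ∫ x, η x • ψ x

/-- `ψ` is the (non-degenerate) ground state of `-Δ + v`, with energy `E`, where
`v ∈ L¹_loc(ℝ³)`. -/
structure IsGroundState (v : R3 → ℝ) (E : ℝ) (ψ : R3 → ℂ) : Prop where
  locallyIntegrable : LocallyIntegrable v
  memW : MemW ψ
  groundEnergy_eq : groundEnergy v = E
  /-- `ψ` attains the infimum that defines the ground-state energy. -/
  hasEnergy : HasEnergy v ψ
  energy_eq : energy v ψ = groundEnergy v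
  /-- `ψ` solves the Schrödinger equation for the energy `E`. -/
  isEigenfunction : IsEigenfunction v E ψ
  /-- Non-degeneracy: the kernel of `E - (-Δ + v)` is spanned by `ψ`. -/
  simple : ∀ φ : R3 → ℂ, IsEigenfunction v E φ → ∃ c : ℂ, φ =ᵐ[volume] fun x => c * ψ x
  /-- Every other minimizer of the energy is a constant multiple of `ψ`. -/
  unique : ∀ φ : R3 → ℂ, HasEnergy v φ → energy v φ = groundEnergy v →
    ∃ c : ℂ, φ =ᵐ[volume] fun x => c * ψ x

/-- `ρ` is `v`-representable (for one electron): it is the particle density `|ψ|²` of the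
ground state `ψ` of `-Δ + v` for some potential `v`. -/
def IsVRepresentable (ρ : R3 → ℝ) : Prop :=
  ∃ (v : R3 → ℝ) (E : ℝ) (ψ : R3 → ℂ), IsGroundState v E ψ ∧ ∀ᵐ x, ‖ψ x‖ ^ 2 = ρ x

end OneElectron

end

/-! The proof is the ground state substitution. Put `u = √ρ > 0`, `f = Δu`, `w = f / u`. Testing the
identity `div(∇u / u) = w - |∇u|² / u²` against `ψ²` and completing the square gives, formally, `∫
|∇ψ|² + ∫ w ψ² = ∫ |∇ψ - ψ ∇u / u|² = ∫ u² |∇(ψ / u)|²`. Hence the energy form of `-Δ + w` is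
nonnegative, and where it vanishes `ψ / u` has zero gradient and is constant. The form does vanish
at `u`, because `-Δu + w u = 0`. Adding `e` to the potential shifts everything by `e`. Complex
functions split into real and imaginary parts.

Since `u` has no positive lower bound and `w` may be unbounded below, only the inequality `≥` is
established for general `ψ`. The exact identity is proved for test functions with `(u + ε)⁻¹` in
place of `u⁻¹` (`IsPositiveProfile.integral_sq_sub`). The limits `ε → 0` and then test functions to
`H¹` use Fatou for the square and for `w₋ ψ²`, while `w₊ ≤ C` controls the other side
(`IsPositiveProfile.integral_lowerDensity_le`). In particular `w ψ²` is integrable for every `ψ ∈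
H¹`, so no energy is infinite or undefined.

Equality is `IsPositiveProfile.exists_ae_eq_const_mul`: local integrability of `u⁻²` makes `ψ / u`
locally integrable, so that its weak gradient makes sense. It also puts `w` in `L¹_loc`.
Eigenfunctions are reduced to the case of equality by testing their equation against themselves
(`HasL2Gradient.integral_grad_sq_eq`). All weak calculus is done by mollifying, using the classical
rules, and passing to the limit with dominating functions that are themselves mollified. -/

noncomputable section

namespace OneElectron

open Filter Topology Convolution ContinuousLinearMap

/-! ### Mollification -/

/-- A bump function at the origin of `ℝ³` whose support shrinks as `n` grows. -/
def bump (n : ℕ) : ContDiffBump (0 : R3) where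
  rIn := 1 / ((n : ℝ) + 1)
  rOut := 2 / ((n : ℝ) + 1)
  rIn_pos := by positivity
  rIn_lt_rOut := by gcongr; norm_num

/-- The mollifier kernel of index `n`. -/
def kernel (n : ℕ) : R3 → ℝ := (bump n).normed volume

/-- The mollification of `g` at scale `n`. -/
def mollify (n : ℕ) (g : R3 → ℝ) : R3 → ℝ := kernel n ⋆[lsmul ℝ ℝ, volume] g

lemma kernel_nonneg (n : ℕ) (x : R3) : 0 ≤ kernel n x := (bump n).nonneg_normed x

lemma integral_kernel (n : ℕ) : ∫ x, kernel n x = 1 := (bump n).integral_normed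

lemma hasCompactSupport_kernel (n : ℕ) : HasCompactSupport (kernel n) :=
  (bump n).hasCompactSupport_normed

lemma contDiff_kernel (n : ℕ) : ContDiff ℝ ∞ (kernel n) := (bump n).contDiff_normed

lemma integrable_kernel (n : ℕ) : Integrable (kernel n) :=
  (contDiff_kernel n).continuous.integrable_of_hasCompactSupport (hasCompactSupport_kernel n)

lemma kernel_eq_zero {n : ℕ} {x : R3} (hx : 2 ≤ ‖x‖) : kernel n x = 0 := by
  have h : x ∉ Function.support (kernel n) := by
    rw [kernel, ContDiffBump.support_normed_eq]
    simp only [Metric.mem_ball, dist_zero_right, not_lt]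
    refine le_trans ?_ hx
    change 2 / ((n : ℝ) + 1) ≤ 2
    exact div_le_self (by norm_num) (by linarith [n.cast_nonneg (α := ℝ)])
  simpa using h

lemma mollify_apply (n : ℕ) (g : R3 → ℝ) (x : R3) :
    mollify n g x = ∫ t, kernel n t * g (x - t) := rfl

lemma mollify_apply_swap (n : ℕ) (g : R3 → ℝ) (x : R3) :
    mollify n g x = ∫ y, kernel n (x - y) * g y := by
  rw [mollify, convolution_eq_swap]; rfl

lemma integrable_kernel_mul {g : R3 → ℝ} (hg : LocallyIntegrable g) (n : ℕ) (x : R3) :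
    Integrable fun t => kernel n t * g (x - t) :=
  (hasCompactSupport_kernel n).convolutionExists_left (lsmul ℝ ℝ)
    (contDiff_kernel n).continuous hg x

lemma abs_mollify_le (n : ℕ) (g : R3 → ℝ) (x : R3) :
    |mollify n g x| ≤ mollify n (fun y => |g y|) x := by
  rw [mollify_apply, mollify_apply]
  refine (norm_integral_le_integral_norm (fun t => kernel n t * g (x - t))).trans_eq ?_
  congr 1; ext t
  rw [norm_mul, Real.norm_of_nonneg (kernel_nonneg n t), Real.norm_eq_abs]

lemma mollify_nonneg {g : R3 → ℝ} (hg : ∀ᵐ x, 0 ≤ g x) (n : ℕ) (x : R3) :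
    0 ≤ mollify n g x := by
  rw [mollify_apply_swap]
  refine integral_nonneg_of_ae ?_
  filter_upwards [hg] with y hy using mul_nonneg (kernel_nonneg _ _) hy

lemma mollify_add {g h : R3 → ℝ} (hg : LocallyIntegrable g) (hh : LocallyIntegrable h)
    (n : ℕ) (x : R3) :
    mollify n (fun y => g y + h y) x = mollify n g x + mollify n h x := by
  simp only [mollify_apply]
  rw [← integral_add (integrable_kernel_mul hg n x) (integrable_kernel_mul hh n x)]
  congr 1; ext t; ring

lemma mollify_const_mul (g : R3 → ℝ) (c : ℝ) (n : ℕ) (x : R3) :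
    mollify n (fun y => c * g y) x = c * mollify n g x := by
  simp only [mollify_apply]
  rw [← integral_const_mul]
  congr 1; ext t; ring

/-- Jensen's inequality: the kernel is a probability density, and the variance of `g` under it is
nonnegative. -/
lemma mollify_sq_le {g : R3 → ℝ} (hg : LocallyIntegrable g)
    (hg2 : LocallyIntegrable fun x => g x ^ 2) (n : ℕ) (x : R3) :
    mollify n g x ^ 2 ≤ mollify n (fun y => g y ^ 2) x := by
  set m := mollify n g x with hm
  have h0 : 0 ≤ ∫ t, kernel n t * (g (x - t) - m) ^ 2 :=
    integral_nonneg fun t => mul_nonneg (kernel_nonneg n t) (sq_nonneg _)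
  have h1 : ∫ t, kernel n t * (g (x - t) - m) ^ 2
      = mollify n (fun y => g y ^ 2) x - 2 * m * m + m ^ 2 := by
    have e : (fun t => kernel n t * (g (x - t) - m) ^ 2) = fun t =>
        kernel n t * g (x - t) ^ 2 - 2 * m * (kernel n t * g (x - t)) + m ^ 2 * kernel n t := by
      ext t; ring
    have i1 := integrable_kernel_mul hg n x
    have i2 := integrable_kernel_mul hg2 n x
    have i3 : Integrable fun t =>
        kernel n t * g (x - t) ^ 2 - 2 * m * (kernel n t * g (x - t)) := i2.sub (i1.const_mul _)
    rw [e, integral_add i3 ((integrable_kernel n).const_mul _),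
      integral_sub i2 (i1.const_mul _), integral_const_mul, integral_const_mul, integral_kernel,
      ← mollify_apply n g, ← hm, mollify_apply]
    ring
  nlinarith

lemma contDiff_mollify {g : R3 → ℝ} (hg : LocallyIntegrable g) (n : ℕ) :
    ContDiff ℝ ∞ (mollify n g) :=
  (hasCompactSupport_kernel n).contDiff_convolution_left _ (contDiff_kernel n) hg

lemma ae_tendsto_mollify {g : R3 → ℝ} (hg : LocallyIntegrable g) :
    ∀ᵐ x, Tendsto (fun n => mollify n g x) atTop (𝓝 (g x)) := by
  have h1 : Tendsto (fun n => (bump n).rOut) atTop (𝓝 0) := by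
    have := (tendsto_one_div_add_atTop_nhds_zero_nat (𝕜 := ℝ)).const_mul 2
    rw [mul_zero] at this
    refine this.congr fun n => ?_
    change _ = 2 / ((n : ℝ) + 1)
    ring
  -- Lebesgue differentiation needs the ratio of the two radii bounded; here it is always exactly 2.
  have h2 : ∀ᶠ n in atTop, (bump n).rOut ≤ 2 * (bump n).rIn :=
    Eventually.of_forall fun n => by
      change 2 / ((n : ℝ) + 1) ≤ 2 * (1 / ((n : ℝ) + 1))
      apply le_of_eq; ring
  exact ContDiffBump.ae_convolution_tendsto_right_of_locallyIntegrable h1 h2 hg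

lemma integrable_mollify {g : R3 → ℝ} (hg : Integrable g) (n : ℕ) : Integrable (mollify n g) :=
  (integrable_kernel n).integrable_convolution (lsmul ℝ ℝ) hg

lemma integral_mollify {g : R3 → ℝ} (hg : Integrable g) (n : ℕ) :
    ∫ x, mollify n g x = ∫ x, g x := by
  rw [mollify, integral_convolution _ (integrable_kernel n) hg, integral_kernel]
  simp

lemma isTest_kernel_sub (n : ℕ) (x : R3) : IsTest fun y => kernel n (x - y) := by
  refine ⟨(contDiff_kernel n).comp (contDiff_const.sub contDiff_id), ?_⟩
  exact (hasCompactSupport_kernel n).comp_homeomorph (Homeomorph.subLeft x)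

lemma partialDeriv_kernel_sub (n : ℕ) (i : Fin 3) (x y : R3) :
    partialDeriv i (fun z => kernel n (x - z)) y = -partialDeriv i (kernel n) (x - y) := by
  have h : HasFDerivAt (fun z => kernel n (x - z))
      ((fderiv ℝ (kernel n) (x - y)).comp (-ContinuousLinearMap.id ℝ R3)) y := by
    refine HasFDerivAt.comp y ?_ ((hasFDerivAt_id y).const_sub x)
    exact ((contDiff_kernel n).differentiable (by simp) _).hasFDerivAt
  simp [partialDeriv, h.fderiv]

/-- The derivative is put on the kernel, as a function of the integration variable. This is the left
side of the definition of a weak derivative, for the test function `y ↦ kernel n (x - y)`; the sign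
comes from the reflection. -/
lemma partialDeriv_mollify {u : R3 → ℝ} (hu : LocallyIntegrable u) (n : ℕ) (i : Fin 3) (x : R3) :
    partialDeriv i (mollify n u) x
      = -∫ y, partialDeriv i (fun z => kernel n (x - z)) y * u y := by
  have h := (hasCompactSupport_kernel n).hasFDerivAt_convolution_left (lsmul ℝ ℝ)
    ((contDiff_kernel n).of_le (by simp)) hu x
  rw [partialDeriv, mollify, h.fderiv, convolution_eq_swap, ← integral_neg]
  have hint : Integrable fun t =>
      ((lsmul ℝ ℝ : ℝ →L[ℝ] ℝ →L[ℝ] ℝ).precompL R3 (fderiv ℝ (kernel n) (x - t))) (u t) := by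
    have := ((hasCompactSupport_kernel n).fderiv ℝ).convolutionExists_left
      ((lsmul ℝ ℝ : ℝ →L[ℝ] ℝ →L[ℝ] ℝ).precompL R3)
      ((contDiff_kernel n).continuous_fderiv (by simp)) hu x
    exact this.integrable_swap
  rw [ContinuousLinearMap.integral_apply hint]
  congr 1; ext y
  rw [partialDeriv_kernel_sub]
  simp [partialDeriv, precompL_apply]

/-! ### Passing to the limit in mollified integrals -/

/-- Dominated convergence with a convergent sequence of dominating functions. -/
lemma tendsto_integral_of_tendsto_bound {α : Type*} [MeasurableSpace α] {μ : Measure α}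
    {F : ℕ → α → ℝ} {f : α → ℝ} {B : ℕ → α → ℝ} {b : α → ℝ}
    (hF : ∀ n, AEStronglyMeasurable (F n) μ) (hB : ∀ n, Integrable (B n) μ)
    (hb : Integrable b μ) (hle : ∀ n, ∀ᵐ x ∂μ, |F n x| ≤ B n x)
    (hFlim : ∀ᵐ x ∂μ, Tendsto (fun n => F n x) atTop (𝓝 (f x)))
    (hBlim : ∀ᵐ x ∂μ, Tendsto (fun n => B n x) atTop (𝓝 (b x)))
    (hint : Tendsto (fun n => ∫ x, B n x ∂μ) atTop (𝓝 (∫ x, b x ∂μ))) :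
    Tendsto (fun n => ∫ x, F n x ∂μ) atTop (𝓝 (∫ x, f x ∂μ)) := by
  have hle' : ∀ᵐ x ∂μ, ∀ n, |F n x| ≤ B n x := ae_all_iff.2 hle
  have hfb : ∀ᵐ x ∂μ, |f x| ≤ b x := by
    filter_upwards [hle', hFlim, hBlim] with x h1 h2 h3
    exact le_of_tendsto_of_tendsto h2.abs h3 (Eventually.of_forall h1)
  -- Truncating `F n` to `[-b, b]` allows ordinary dominated convergence. The truncation error is at
  -- most `B n - min (B n) b`, whose integral tends to 0 by `hint`.
  set K : ℕ → α → ℝ := fun n x => max (-b x) (min (F n x) (b x)) with hK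
  have hKm : ∀ n, AEStronglyMeasurable (K n) μ := fun n =>
    hb.1.neg.sup ((hF n).inf hb.1)
  have hKb : ∀ n, ∀ᵐ x ∂μ, ‖K n x‖ ≤ b x := fun n => by
    filter_upwards [hfb] with x hx
    have hx0 : 0 ≤ b x := (abs_nonneg _).trans hx
    rw [Real.norm_eq_abs, abs_le]
    exact ⟨le_max_left _ _, max_le (by linarith) (min_le_right _ _)⟩
  have hKlim : Tendsto (fun n => ∫ x, K n x ∂μ) atTop (𝓝 (∫ x, f x ∂μ)) := by
    refine tendsto_integral_of_dominated_convergence b hKm hb hKb ?_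
    filter_upwards [hfb, hFlim] with x h1 h2
    have h3 : Tendsto (fun n => K n x) atTop (𝓝 (max (-b x) (min (f x) (b x)))) :=
      tendsto_const_nhds.max (h2.min tendsto_const_nhds)
    rwa [min_eq_left (abs_le.1 h1).2, max_eq_right (abs_le.1 h1).1] at h3
  have hKi : ∀ n, Integrable (K n) μ := fun n => hb.mono' (hKm n) (hKb n)
  have hFi : ∀ n, Integrable (F n) μ := fun n => (hB n).mono' (hF n) (hle n)
  set M : ℕ → α → ℝ := fun n x => min (B n x) (b x) with hM
  have hMi : ∀ n, Integrable (M n) μ := fun n => (hB n).inf hb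
  have hMlim : Tendsto (fun n => ∫ x, M n x ∂μ) atTop (𝓝 (∫ x, b x ∂μ)) := by
    refine tendsto_integral_of_dominated_convergence b (fun n => (hMi n).1) hb (fun n => ?_) ?_
    · filter_upwards [hfb, hle'] with x h1 h2
      have h3 : 0 ≤ b x := (abs_nonneg _).trans h1
      have h4 : 0 ≤ B n x := (abs_nonneg _).trans (h2 n)
      rw [Real.norm_of_nonneg (le_min h4 h3)]
      exact min_le_right _ _
    · filter_upwards [hBlim] with x h1
      simpa using h1.min (tendsto_const_nhds (x := b x))
  have hdiff : Tendsto (fun n => ∫ x, F n x ∂μ - ∫ x, K n x ∂μ) atTop (𝓝 0) := by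
    have h0 : Tendsto (fun n => ∫ x, B n x ∂μ - ∫ x, M n x ∂μ) atTop (𝓝 0) := by
      simpa using hint.sub hMlim
    refine squeeze_zero_norm (fun n => ?_) h0
    rw [← integral_sub (hFi n) (hKi n), ← integral_sub (hB n) (hMi n)]
    refine norm_integral_le_of_norm_le ((hB n).sub (hMi n)) ?_
    filter_upwards [hle n, hfb] with x h1 h2
    have h3 : 0 ≤ b x := (abs_nonneg _).trans h2
    obtain ⟨h4, h5⟩ := abs_le.1 h1
    rw [Real.norm_eq_abs, abs_le, hK, hM]
    dsimp only
    rcases le_total (F n x) (b x) with h6 | h6 <;> rcases le_total (B n x) (b x) with h7 | h7 <;>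
      rcases le_total (-b x) (F n x) with h8 | h8 <;>
      simp only [min_eq_left, min_eq_right, max_eq_left, max_eq_right, h6, h7, h8,
        neg_le_self_iff.2 h3] <;> constructor <;> linarith
  simpa using hdiff.add hKlim

/-- All kernels vanish outside the ball of radius 2, so the margin 2 works for every `n`. -/
lemma mollify_congr_of_norm_le {b c : R3 → ℝ} {R : ℝ} (h : ∀ y, ‖y‖ ≤ R + 2 → b y = c y)
    (n : ℕ) {x : R3} (hx : ‖x‖ ≤ R) : mollify n b x = mollify n c x := by
  rw [mollify_apply, mollify_apply]
  congr 1; ext t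
  by_cases ht : 2 ≤ ‖t‖
  · simp [kernel_eq_zero ht]
  · rw [h]
    exact (norm_sub_le _ _).trans (by linarith [not_le.1 ht])

/-- Convergence of integrals against a compactly supported function, the dominating functions
being mollifications of a locally integrable function. -/
lemma tendsto_integral_mul_of_le_mollify {χ : R3 → ℝ} (hχ : Continuous χ)
    (hχs : HasCompactSupport χ) {a : ℕ → R3 → ℝ} {A b : R3 → ℝ}
    (ha : ∀ n, AEStronglyMeasurable (a n)) (hb : LocallyIntegrable b)
    (hle : ∀ n x, |a n x| ≤ mollify n b x)
    (hlim : ∀ᵐ x, Tendsto (fun n => a n x) atTop (𝓝 (A x))) :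
    Tendsto (fun n => ∫ x, χ x * a n x) atTop (𝓝 (∫ x, χ x * A x)) := by
  obtain ⟨K, hK⟩ := hχs.exists_bound_of_continuous hχ
  obtain ⟨R, hR⟩ := hχs.isCompact.isBounded.subset_closedBall (0 : R3)
  have hK0 : 0 ≤ K := (norm_nonneg _).trans (hK 0)
  -- Cutting `|b|` off outside radius `R + 2` makes it integrable without changing its
  -- mollifications on the ball containing the support of `χ`. Mollification preserves its integral,
  -- so the dominating integrals are constant.
  set b' : R3 → ℝ := (Metric.closedBall (0 : R3) (R + 2)).indicator fun y => |b y| with hb'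
  have hb'i : Integrable b' :=
    (integrable_indicator_iff Metric.isClosed_closedBall.measurableSet).2
      (hb.integrableOn_isCompact (isCompact_closedBall _ _)).abs
  have hb'0 : ∀ y, 0 ≤ b' y := fun y => Set.indicator_nonneg (fun y _ => abs_nonneg _) y
  refine tendsto_integral_of_tendsto_bound (B := fun n x => K * mollify n b' x)
    (b := fun x => K * b' x) (fun n => hχ.aestronglyMeasurable.mul (ha n))
    (fun n => (integrable_mollify hb'i n).const_mul K) (hb'i.const_mul K) ?_ ?_ ?_ ?_
  · refine fun n => Eventually.of_forall fun x => ?_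
    by_cases hx : ‖x‖ ≤ R
    · have h1 : mollify n (fun y => |b y|) x = mollify n b' x := by
        refine mollify_congr_of_norm_le (R := R) (fun y hy => ?_) n hx
        rw [hb', Set.indicator_of_mem]
        simpa using hy
      rw [abs_mul, ← h1]
      exact mul_le_mul (hK x) ((hle n x).trans ((le_abs_self _).trans (abs_mollify_le n b x)))
        (abs_nonneg _) hK0
    · have : χ x = 0 := by
        by_contra hne
        exact hx (by simpa using hR (subset_tsupport χ hne))
      simpa [this] using
        mul_nonneg hK0 (mollify_nonneg (Eventually.of_forall hb'0) n x)
  · filter_upwards [hlim] with x hx using hx.const_mul _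
  · filter_upwards [ae_tendsto_mollify hb'i.locallyIntegrable] with x hx using hx.const_mul K
  · simp only [integral_const_mul, integral_mollify hb'i]
    exact tendsto_const_nhds

/-! ### Weak derivatives of real functions -/

/-- `g` is the weak partial derivative of `u` in the `i`-th direction. -/
structure HasWeakPartial (i : Fin 3) (u g : R3 → ℝ) : Prop where
  locallyIntegrable : LocallyIntegrable u
  locallyIntegrable_partial : LocallyIntegrable g
  integral_eq : ∀ η : R3 → ℝ, IsTest η → ∫ x, partialDeriv i η x * u x = -∫ x, η x * g x

/-- `T` is the weak divergence of the vector field `g`. -/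
structure HasWeakDivergence (g : Fin 3 → R3 → ℝ) (T : R3 → ℝ) : Prop where
  locallyIntegrable : ∀ i, LocallyIntegrable (g i)
  locallyIntegrable_divergence : LocallyIntegrable T
  integral_eq : ∀ η : R3 → ℝ, IsTest η →
    ∑ i, ∫ x, partialDeriv i η x * g i x = -∫ x, η x * T x

/-- The real function `u` belongs to `H¹(ℝ³)` and its weak gradient is `g`. -/
structure HasL2Gradient (u : R3 → ℝ) (g : Fin 3 → R3 → ℝ) : Prop where
  memLp : MemLp u 2
  memLp_grad : ∀ i, MemLp (g i) 2
  hasWeakPartial : ∀ i, HasWeakPartial i u (g i)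

lemma HasWeakPartial.partialDeriv_mollify {i : Fin 3} {u g : R3 → ℝ} (h : HasWeakPartial i u g)
    (n : ℕ) (x : R3) : partialDeriv i (mollify n u) x = mollify n g x := by
  rw [OneElectron.partialDeriv_mollify h.locallyIntegrable, h.integral_eq _ (isTest_kernel_sub n x),
    neg_neg, mollify_apply_swap]

/-- Only the sum is identified: a single `∂ᵢ gᵢ` need not be a function. -/
lemma HasWeakDivergence.sum_partialDeriv_mollify {g : Fin 3 → R3 → ℝ} {T : R3 → ℝ}
    (h : HasWeakDivergence g T) (n : ℕ) (x : R3) :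
    ∑ i, partialDeriv i (mollify n (g i)) x = mollify n T x := by
  simp only [fun i => OneElectron.partialDeriv_mollify (h.locallyIntegrable i) n i x]
  rw [Finset.sum_neg_distrib, h.integral_eq _ (isTest_kernel_sub n x), neg_neg,
    mollify_apply_swap]

lemma continuous_partialDeriv {u : R3 → ℝ} (hu : ContDiff ℝ ∞ u) (i : Fin 3) :
    Continuous (partialDeriv i u) :=
  (hu.continuous_fderiv (by simp)).clm_apply continuous_const

lemma contDiff_partialDeriv {u : R3 → ℝ} (hu : ContDiff ℝ ∞ u) (i : Fin 3) :
    ContDiff ℝ ∞ (partialDeriv i u) :=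
  (hu.fderiv_right (m := ∞) (by simp)).clm_apply contDiff_const

lemma IsTest.partialDeriv {η : R3 → ℝ} (hη : IsTest η) (i : Fin 3) :
    IsTest (OneElectron.partialDeriv i η) :=
  ⟨contDiff_partialDeriv hη.1 i, hη.2.fderiv_apply (𝕜 := ℝ) _⟩

lemma IsTest.mul_left {η χ : R3 → ℝ} (hη : ContDiff ℝ ∞ η) (hχ : IsTest χ) :
    IsTest fun x => η x * χ x :=
  ⟨hη.mul hχ.1, hχ.2.mul_left⟩

lemma partialDeriv_mul {u v : R3 → ℝ} (hu : ContDiff ℝ ∞ u) (hv : ContDiff ℝ ∞ v) (i : Fin 3)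
    (x : R3) : partialDeriv i (fun y => u y * v y) x
      = partialDeriv i u x * v x + u x * partialDeriv i v x := by
  have hu' := (hu.differentiable (by simp) x).hasFDerivAt
  have hv' := (hv.differentiable (by simp) x).hasFDerivAt
  have h : HasFDerivAt (fun y => u y * v y) _ x := hu'.mul hv'
  simp [partialDeriv, h.fderiv]
  ring

lemma partialDeriv_mul_comp {a b : R3 → ℝ} (ha : ContDiff ℝ ∞ a) (hb : ContDiff ℝ ∞ b)
    {F F' : ℝ → ℝ} {x : R3} (hF : HasDerivAt F (F' (b x)) (b x)) (i : Fin 3) :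
    DifferentiableAt ℝ (fun y => a y * F (b y)) x ∧
    partialDeriv i (fun y => a y * F (b y)) x
      = partialDeriv i a x * F (b x) + a x * (F' (b x) * partialDeriv i b x) := by
  have ha' := (ha.differentiable (by simp) x).hasFDerivAt
  have hb' := (hb.differentiable (by simp) x).hasFDerivAt
  have h := ha'.mul (hF.comp_hasFDerivAt x hb')
  have h' : HasFDerivAt (fun y => a y * F (b y)) _ x := h
  refine ⟨h'.differentiableAt, ?_⟩
  simp [partialDeriv, h'.fderiv]
  ring

/-- Integration by parts of `a F(b)` against a test function, for smooth `a` and `b`. -/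
lemma integral_test_mul_comp {χ a b : R3 → ℝ} (hχ : IsTest χ) (ha : ContDiff ℝ ∞ a)
    (hb : ContDiff ℝ ∞ b) {F F' : ℝ → ℝ} {s : Set ℝ} (hF : ∀ t ∈ s, HasDerivAt F (F' t) t)
    (hF' : ContinuousOn F' s) (hs : ∀ x, b x ∈ s) (i : Fin 3) :
    ∫ x, χ x * (partialDeriv i a x * F (b x) + a x * (F' (b x) * partialDeriv i b x))
      = -∫ x, partialDeriv i χ x * (a x * F (b x)) := by
  have hd := fun x => partialDeriv_mul_comp ha hb (hF _ (hs x)) i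
  have hc : Continuous fun x => a x * F (b x) :=
    continuous_iff_continuousAt.2 fun x => (hd x).1.continuousAt
  have hFb : Continuous fun x => F (b x) :=
    (ContinuousOn.comp_continuous (fun t ht => (hF t ht).continuousAt.continuousWithinAt)
      hb.continuous hs)
  have hF'b : Continuous fun x => F' (b x) := hF'.comp_continuous hb.continuous hs
  have hc' : Continuous fun x =>
      partialDeriv i a x * F (b x) + a x * (F' (b x) * partialDeriv i b x) :=
    ((continuous_partialDeriv ha i).mul hFb).add
      (ha.continuous.mul (hF'b.mul (continuous_partialDeriv hb i)))
  have hχi := hχ.partialDeriv i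
  have key := integral_mul_fderiv_eq_neg_fderiv_mul_of_integrable (μ := (volume : Measure R3))
    (f := χ) (g := fun x => a x * F (b x)) (v := EuclideanSpace.single i 1)
    ((hχi.1.continuous.mul hc).integrable_of_hasCompactSupport hχi.2.mul_right)
    (((hχ.1.continuous.mul hc').integrable_of_hasCompactSupport hχ.2.mul_right).congr
      (Eventually.of_forall fun x => congrArg (χ x * ·) (hd x).2.symm))
    ((hχ.1.continuous.mul hc).integrable_of_hasCompactSupport hχ.2.mul_right)
    (fun x _ => hχ.1.differentiable (by simp) x) (fun x _ => (hd x).1)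
  simp only [← (hd _).2]
  exact key

/-! ### Composition with bounded `C¹` functions -/

/-- `F` is `C¹` with derivative `F'`, both bounded by `K` along the set `s`, and `s` contains the
values of `φ` and of its mollifications. -/
structure IsBoundedC1Along (φ : R3 → ℝ) (F F' : ℝ → ℝ) (K : ℝ) (s : Set ℝ) : Prop where
  hasDerivAt : ∀ t ∈ s, HasDerivAt F (F' t) t
  continuousOn : ContinuousOn F' s
  abs_le : ∀ t ∈ s, |F t| ≤ K
  abs_deriv_le : ∀ t ∈ s, |F' t| ≤ K
  mollify_mem : ∀ n x, mollify n φ x ∈ s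
  ae_mem : ∀ᵐ x, φ x ∈ s

section

variable {φ : R3 → ℝ} {F F' : ℝ → ℝ} {K : ℝ} {s : Set ℝ}

lemma IsBoundedC1Along.nonneg (h : IsBoundedC1Along φ F F' K s) : 0 ≤ K :=
  (abs_nonneg _).trans (h.abs_le _ (h.mollify_mem 0 0))

lemma IsBoundedC1Along.continuous_comp (h : IsBoundedC1Along φ F F' K s)
    (hφ : LocallyIntegrable φ) (n : ℕ) : Continuous fun x => F (mollify n φ x) :=
  ContinuousOn.comp_continuous (fun t ht => (h.hasDerivAt t ht).continuousAt.continuousWithinAt)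
    (contDiff_mollify hφ n).continuous (h.mollify_mem n)

lemma IsBoundedC1Along.continuous_deriv_comp (h : IsBoundedC1Along φ F F' K s)
    (hφ : LocallyIntegrable φ) (n : ℕ) : Continuous fun x => F' (mollify n φ x) :=
  h.continuousOn.comp_continuous (contDiff_mollify hφ n).continuous (h.mollify_mem n)

lemma IsBoundedC1Along.ae_tendsto (h : IsBoundedC1Along φ F F' K s)
    (hφ : LocallyIntegrable φ) :
    ∀ᵐ x, Tendsto (fun n => F (mollify n φ x)) atTop (𝓝 (F (φ x))) := by
  filter_upwards [h.ae_mem, ae_tendsto_mollify hφ] with x h1 h2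
  exact (h.hasDerivAt _ h1).continuousAt.tendsto.comp h2

lemma IsBoundedC1Along.ae_tendsto_deriv (h : IsBoundedC1Along φ F F' K s)
    (hφ : LocallyIntegrable φ) :
    ∀ᵐ x, Tendsto (fun n => F' (mollify n φ x)) atTop (𝓝 (F' (φ x))) := by
  filter_upwards [h.ae_mem, ae_tendsto_mollify hφ] with x h1 h2
  exact (h.continuousOn _ h1).tendsto.comp
    (tendsto_nhdsWithin_iff.2 ⟨h2, Eventually.of_forall fun n => h.mollify_mem n x⟩)

lemma IsBoundedC1Along.aestronglyMeasurable (h : IsBoundedC1Along φ F F' K s)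
    (hφ : LocallyIntegrable φ) : AEStronglyMeasurable (fun x => F (φ x)) :=
  aestronglyMeasurable_of_tendsto_ae atTop
    (fun n => (h.continuous_comp hφ n).aestronglyMeasurable) (h.ae_tendsto hφ)

lemma IsBoundedC1Along.aestronglyMeasurable_deriv (h : IsBoundedC1Along φ F F' K s)
    (hφ : LocallyIntegrable φ) : AEStronglyMeasurable (fun x => F' (φ x)) :=
  aestronglyMeasurable_of_tendsto_ae atTop
    (fun n => (h.continuous_deriv_comp hφ n).aestronglyMeasurable) (h.ae_tendsto_deriv hφ)

end

lemma _root_.MeasureTheory.LocallyIntegrable.abs {u : R3 → ℝ} (hu : LocallyIntegrable u) :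
    LocallyIntegrable fun x => |u x| := fun x => by
  obtain ⟨t, ht, h⟩ := hu x
  exact ⟨t, ht, Integrable.abs h⟩

lemma _root_.MeasureTheory.LocallyIntegrable.const_mul' {u : R3 → ℝ} (hu : LocallyIntegrable u)
    (c : ℝ) : LocallyIntegrable fun x => c * u x := hu.smul c

lemma _root_.MeasureTheory.MemLp.locallyIntegrable_two {u : R3 → ℝ} (hu : MemLp u 2) :
    LocallyIntegrable u :=
  hu.locallyIntegrable (by norm_num)

/-- If the vector field `g` with divergence `T` is the gradient of `φ`, then
`F(φ) g` has divergence `F'(φ) |g|² + F(φ) T`. -/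
lemma HasL2Gradient.integral_test_comp {φ T : R3 → ℝ} {g : Fin 3 → R3 → ℝ}
    (hφ : HasL2Gradient φ g) (hT : HasWeakDivergence g T) {F F' : ℝ → ℝ} {K : ℝ} {s : Set ℝ}
    (h : IsBoundedC1Along φ F F' K s) {χ : R3 → ℝ} (hχ : IsTest χ) :
    (∑ i, ∫ x, χ x * (F' (φ x) * g i x ^ 2)) + (∫ x, χ x * (T x * F (φ x)))
      = -∑ i, ∫ x, partialDeriv i χ x * (g i x * F (φ x)) := by
  have hφl := hφ.memLp.locallyIntegrable_two
  have hgl := fun i => (hφ.memLp_grad i).locallyIntegrable_two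
  have hgs : ∀ i, LocallyIntegrable fun x => g i x ^ 2 := fun i =>
    (hφ.memLp_grad i).integrable_sq.locallyIntegrable
  have hTl := hT.locallyIntegrable_divergence
  have hK := h.nonneg
  have cF := h.continuous_comp hφl
  have cF' := h.continuous_deriv_comp hφl
  have cg := fun n i => (contDiff_mollify (hgl i) n).continuous
  -- The identity holds classically for the mollified data: the gradient of `mollify n φ` is the
  -- mollified `g`, which produces the square, and the mollified field has divergence `mollify n T`.
  have hn : ∀ n, (∑ i, ∫ x, χ x * (F' (mollify n φ x) * mollify n (g i) x ^ 2))
      + (∫ x, χ x * (mollify n T x * F (mollify n φ x)))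
      = -∑ i, ∫ x, partialDeriv i χ x * (mollify n (g i) x * F (mollify n φ x)) := by
    intro n
    have e1 := fun i => integral_test_mul_comp hχ (contDiff_mollify (hgl i) n)
      (contDiff_mollify hφl n) h.hasDerivAt h.continuousOn (h.mollify_mem n) i
    rw [← Finset.sum_neg_distrib]
    simp only [← e1]
    have cd := fun i => continuous_partialDeriv (contDiff_mollify (hgl i) n) i
    have e2 : ∀ i, ∫ x, χ x * (partialDeriv i (mollify n (g i)) x * F (mollify n φ x)
        + mollify n (g i) x * (F' (mollify n φ x) * partialDeriv i (mollify n φ) x))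
        = (∫ x, χ x * (F' (mollify n φ x) * mollify n (g i) x ^ 2))
          + (∫ x, χ x * (partialDeriv i (mollify n (g i)) x * F (mollify n φ x))) := by
      intro i
      rw [← integral_add]
      · congr 1; ext x
        rw [(hφ.hasWeakPartial i).partialDeriv_mollify]; ring
      · exact (hχ.1.continuous.mul ((cF' n).mul
          ((cg n i).pow 2))).integrable_of_hasCompactSupport hχ.2.mul_right
      · exact (hχ.1.continuous.mul ((cd i).mul
          (cF n))).integrable_of_hasCompactSupport hχ.2.mul_right
    simp only [e2, Finset.sum_add_distrib]
    congr 1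
    rw [← integral_finsetSum]
    · congr 1; ext x
      rw [← hT.sum_partialDeriv_mollify, Finset.sum_mul, Finset.mul_sum]
    · exact fun i _ => (hχ.1.continuous.mul ((cd i).mul
          (cF n))).integrable_of_hasCompactSupport hχ.2.mul_right
  have l1 : ∀ i, Tendsto (fun n => ∫ x, χ x * (F' (mollify n φ x) * mollify n (g i) x ^ 2)) atTop
      (𝓝 (∫ x, χ x * (F' (φ x) * g i x ^ 2))) := by
    intro i
    refine tendsto_integral_mul_of_le_mollify hχ.1.continuous hχ.2 (b := fun x => K * g i x ^ 2)
      (fun n => ((cF' n).mul ((cg n i).pow 2)).aestronglyMeasurable)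
      ((hφ.memLp_grad i).integrable_sq.const_mul K).locallyIntegrable (fun n x => ?_) ?_
    · rw [mollify_const_mul, abs_mul, abs_of_nonneg (sq_nonneg (mollify n (g i) x))]
      exact mul_le_mul (h.abs_deriv_le _ (h.mollify_mem n x)) (mollify_sq_le (hgl i) (hgs i) n x)
        (sq_nonneg _) hK
    · filter_upwards [h.ae_tendsto_deriv hφl, ae_tendsto_mollify (hgl i)] with x h1 h2
      exact h1.mul (h2.pow 2)
  have l2 : ∀ {η T : R3 → ℝ}, IsTest η → LocallyIntegrable T →
      Tendsto (fun n => ∫ x, η x * (mollify n T x * F (mollify n φ x))) atTop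
      (𝓝 (∫ x, η x * (T x * F (φ x)))) := by
    intro η T hη hTl
    refine tendsto_integral_mul_of_le_mollify hη.1.continuous hη.2 (b := fun x => K * |T x|)
      (fun n => ((contDiff_mollify hTl n).continuous.mul (cF n)).aestronglyMeasurable)
      ?_ (fun n x => ?_) ?_
    · exact hTl.abs.const_mul' K
    · rw [mollify_const_mul, abs_mul, mul_comm]
      exact mul_le_mul (h.abs_le _ (h.mollify_mem n x)) (abs_mollify_le n _ x) (abs_nonneg _) hK
    · filter_upwards [h.ae_tendsto hφl, ae_tendsto_mollify hTl] with x h1 h2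
      exact h2.mul h1
  refine tendsto_nhds_unique (((tendsto_finsetSum _ fun i _ => l1 i).add (l2 hχ hTl)).congr hn)
    (tendsto_finsetSum _ fun i _ => l2 (hχ.partialDeriv i) (hgl i)).neg

/-- The product rule for the weak gradient of `ψ F(u)`. -/
lemma HasL2Gradient.hasWeakPartial_mul_comp {ψ u : R3 → ℝ} {gψ g : Fin 3 → R3 → ℝ}
    (hψ : HasL2Gradient ψ gψ) (hu : HasL2Gradient u g) {F F' : ℝ → ℝ} {K : ℝ} {s : Set ℝ}
    (h : IsBoundedC1Along u F F' K s) {χ : R3 → ℝ} (hχ : IsTest χ) (i : Fin 3) :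
    ∫ x, χ x * (gψ i x * F (u x) + ψ x * (F' (u x) * g i x))
      = -∫ x, partialDeriv i χ x * (ψ x * F (u x)) := by
  have hul := hu.memLp.locallyIntegrable_two
  have hψl := hψ.memLp.locallyIntegrable_two
  have hgl := (hu.memLp_grad i).locallyIntegrable_two
  have hgψl := (hψ.memLp_grad i).locallyIntegrable_two
  have hK := h.nonneg
  have cF := h.continuous_comp hul
  have cF' := h.continuous_deriv_comp hul
  have cm : ∀ {v : R3 → ℝ}, LocallyIntegrable v → ∀ n, Continuous (mollify n v) :=
    fun hv n => (contDiff_mollify hv n).continuous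
  have hn := fun n => integral_test_mul_comp hχ (contDiff_mollify hψl n)
      (contDiff_mollify hul n) h.hasDerivAt h.continuousOn (h.mollify_mem n) i
  simp only [(hu.hasWeakPartial i).partialDeriv_mollify,
    (hψ.hasWeakPartial i).partialDeriv_mollify] at hn
  have habs : ∀ n x, |F (mollify n u x)| ≤ K := fun n x => h.abs_le _ (h.mollify_mem n x)
  have habs' : ∀ n x, |F' (mollify n u x)| ≤ K := fun n x => h.abs_deriv_le _ (h.mollify_mem n x)
  have i1 : LocallyIntegrable fun x => |gψ i x| := hgψl.abs
  have i2 : LocallyIntegrable fun x => ψ x ^ 2 := hψ.memLp.integrable_sq.locallyIntegrable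
  have i3 : LocallyIntegrable fun x => g i x ^ 2 :=
    (hu.memLp_grad i).integrable_sq.locallyIntegrable
  have i12 : LocallyIntegrable fun x => |gψ i x| + ψ x ^ 2 := by
    have h := i1.add i2
    exact h
  have i123 : LocallyIntegrable fun x => |gψ i x| + ψ x ^ 2 + g i x ^ 2 := by
    have h := i12.add i3
    exact h
  have l1 : Tendsto (fun n => ∫ x, χ x * (mollify n (gψ i) x * F (mollify n u x)
      + mollify n ψ x * (F' (mollify n u x) * mollify n (g i) x))) atTop
      (𝓝 (∫ x, χ x * (gψ i x * F (u x) + ψ x * (F' (u x) * g i x)))) := by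
    -- The product of `ψ` and `g i` is dominated through `|a b| ≤ a² + b²`, so that Jensen bounds it
    -- by a mollified locally integrable function.
    refine tendsto_integral_mul_of_le_mollify
      (a := fun n x => mollify n (gψ i) x * F (mollify n u x)
        + mollify n ψ x * (F' (mollify n u x) * mollify n (g i) x))
      (χ := χ) (A := fun x => gψ i x * F (u x) + ψ x * (F' (u x) * g i x))
      (b := fun x => K * (|gψ i x| + ψ x ^ 2 + g i x ^ 2)) hχ.1.continuous hχ.2
      (fun n => ?_) ?_ (fun n x => ?_) ?_
    · exact (((cm hgψl n).mul (cF n)).add ((cm hψl n).mul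
        ((cF' n).mul (cm hgl n)))).aestronglyMeasurable
    · exact i123.const_mul' K
    · rw [mollify_const_mul, mollify_add i12 i3, mollify_add i1 i2]
      have h1 := abs_mollify_le n (gψ i) x
      have h2 := mollify_sq_le hψl i2 n x
      have h3 := mollify_sq_le hgl i3 n x
      have h0 := abs_add_le (mollify n (gψ i) x * F (mollify n u x))
        (mollify n ψ x * (F' (mollify n u x) * mollify n (g i) x))
      rw [abs_mul, abs_mul, abs_mul] at h0
      refine h0.trans ?_
      have h4 : |mollify n (gψ i) x| * |F (mollify n u x)| ≤ K * |mollify n (gψ i) x| := by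
        rw [mul_comm]; gcongr; exact habs n x
      have h5 : |mollify n ψ x| * (|F' (mollify n u x)| * |mollify n (g i) x|)
          ≤ K * (|mollify n ψ x| * |mollify n (g i) x|) := by
        rw [mul_left_comm]; gcongr; exact habs' n x
      have h6 : |mollify n ψ x| * |mollify n (g i) x|
          ≤ mollify n ψ x ^ 2 + mollify n (g i) x ^ 2 := by
        rw [← sq_abs (mollify n ψ x), ← sq_abs (mollify n (g i) x)]
        linarith [two_mul_le_add_sq |mollify n ψ x| |mollify n (g i) x|,
          mul_nonneg (abs_nonneg (mollify n ψ x)) (abs_nonneg (mollify n (g i) x))]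
      calc _ ≤ K * (|mollify n (gψ i) x| + |mollify n ψ x| * |mollify n (g i) x|) := by linarith
        _ ≤ _ := mul_le_mul_of_nonneg_left (by linarith) hK
    · filter_upwards [h.ae_tendsto hul, h.ae_tendsto_deriv hul, ae_tendsto_mollify hψl,
        ae_tendsto_mollify hgl, ae_tendsto_mollify hgψl] with x h1 h2 h3 h4 h5
      exact (h5.mul h1).add (h3.mul (h2.mul h4))
  have l2 : Tendsto (fun n => ∫ x, partialDeriv i χ x * (mollify n ψ x * F (mollify n u x))) atTop
      (𝓝 (∫ x, partialDeriv i χ x * (ψ x * F (u x)))) := by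
    have hc : Continuous (partialDeriv i χ) := (hχ.partialDeriv i).1.continuous
    have hc' : HasCompactSupport (partialDeriv i χ) := (hχ.partialDeriv i).2
    refine tendsto_integral_mul_of_le_mollify (χ := partialDeriv i χ)
      (a := fun n x => mollify n ψ x * F (mollify n u x)) (A := fun x => ψ x * F (u x))
      (b := fun x => K * |ψ x|) hc hc'
      (fun n => ?_) ?_ (fun n x => ?_) ?_
    · exact ((cm hψl n).mul (cF n)).aestronglyMeasurable
    · exact hψl.abs.const_mul' K
    · rw [mollify_const_mul, abs_mul, mul_comm]
      exact mul_le_mul (habs n x) (abs_mollify_le n _ x) (abs_nonneg _) hK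
    · filter_upwards [h.ae_tendsto hul, ae_tendsto_mollify hψl] with x h1 h2
      exact h2.mul h1
  exact tendsto_nhds_unique (l1.congr hn) l2.neg

/-! ### Smooth cutoffs -/

/-- A bump function equal to `1` on the unit ball. -/
def unitBump : ContDiffBump (0 : R3) := ⟨1, 2, one_pos, one_lt_two⟩

/-- Smooth cutoff functions, equal to `1` on balls of growing radius. -/
def cutoff (n : ℕ) (x : R3) : ℝ := unitBump (((n : ℝ) + 1)⁻¹ • x)

lemma isTest_cutoff (n : ℕ) : IsTest (cutoff n) := by
  refine ⟨unitBump.contDiff.comp (contDiff_const_smul _), ?_⟩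
  have h : ((n : ℝ) + 1)⁻¹ ≠ 0 := by positivity
  exact unitBump.hasCompactSupport.comp_homeomorph (Homeomorph.smulOfNeZero _ h)

lemma cutoff_nonneg (n : ℕ) (x : R3) : 0 ≤ cutoff n x := unitBump.nonneg

lemma cutoff_le_one (n : ℕ) (x : R3) : cutoff n x ≤ 1 := unitBump.le_one

lemma tendsto_cutoff (x : R3) : Tendsto (fun n => cutoff n x) atTop (𝓝 1) := by
  have h1 : Tendsto (fun n : ℕ => ((n : ℝ) + 1)⁻¹ • x) atTop (𝓝 ((0 : ℝ) • x)) := by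
    have := (tendsto_one_div_add_atTop_nhds_zero_nat (𝕜 := ℝ)).smul_const x
    simpa using this
  have h2 := (unitBump.continuous.tendsto ((0 : ℝ) • x)).comp h1
  have h3 : unitBump ((0 : ℝ) • x) = 1 :=
    unitBump.one_of_mem_closedBall (by simp [unitBump])
  rwa [h3] at h2

/-- By scaling, the gradient of the cutoff at radius `n + 1` is smaller by the factor `1 / (n + 1)`.
This makes the boundary terms disappear in the limit. -/
lemma exists_abs_partialDeriv_cutoff_le :
    ∃ M : ℝ, 0 ≤ M ∧ ∀ n i x, |partialDeriv i (cutoff n) x| ≤ M * (1 / ((n : ℝ) + 1)) := by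
  obtain ⟨M, hM⟩ := (unitBump.hasCompactSupport.fderiv ℝ).exists_bound_of_continuous
    ((unitBump.contDiff (n := ⊤)).continuous_fderiv (by simp))
  refine ⟨M, (norm_nonneg _).trans (hM 0), fun n i x => ?_⟩
  set c : ℝ := ((n : ℝ) + 1)⁻¹ with hc
  have hc0 : 0 ≤ c := by positivity
  have h : HasFDerivAt (cutoff n)
      ((fderiv ℝ unitBump (c • x)).comp (c • ContinuousLinearMap.id ℝ R3)) x := by
    refine HasFDerivAt.comp (f := fun y : R3 => c • y) x ?_ ((hasFDerivAt_id x).const_smul c)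
    exact ((unitBump.contDiff (n := ⊤)).differentiable (by simp) _).hasFDerivAt
  have h1 : partialDeriv i (cutoff n) x
      = c * fderiv ℝ unitBump (c • x) (EuclideanSpace.single i 1) := by
    simp [partialDeriv, h.fderiv]
  rw [h1, abs_mul, abs_of_nonneg hc0, mul_comm, one_div]
  refine mul_le_mul_of_nonneg_right ?_ hc0
  refine ((fderiv ℝ unitBump (c • x)).le_opNorm _).trans ?_
  simpa using hM (c • x)

/-! ### The energy inequality for real functions -/

/-- Fatou's lemma for nonnegative real functions with bounded integrals. -/
lemma integrable_and_integral_le_of_tendsto {α : Type*} [MeasurableSpace α] {μ : Measure α}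
    {F : ℕ → α → ℝ} {f : α → ℝ} {c : ℕ → ℝ} {L : ℝ} (hF : ∀ n, Integrable (F n) μ)
    (h0 : ∀ n, ∀ᵐ x ∂μ, 0 ≤ F n x)
    (hlim : ∀ᵐ x ∂μ, Tendsto (fun n => F n x) atTop (𝓝 (f x)))
    (hc : ∀ n, ∫ x, F n x ∂μ ≤ c n) (hL : Tendsto c atTop (𝓝 L)) :
    Integrable f μ ∧ ∫ x, f x ∂μ ≤ L := by
  have hf0 : ∀ᵐ x ∂μ, 0 ≤ f x := by
    filter_upwards [ae_all_iff.2 h0, hlim] with x h1 h2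
    exact ge_of_tendsto' h2 h1
  have hfm : AEStronglyMeasurable f μ :=
    aestronglyMeasurable_of_tendsto_ae atTop (fun n => (hF n).1) hlim
  have hfat : ∫⁻ x, ENNReal.ofReal (f x) ∂μ ≤ ENNReal.ofReal L := by
    calc ∫⁻ x, ENNReal.ofReal (f x) ∂μ
        = ∫⁻ x, liminf (fun n => ENNReal.ofReal (F n x)) atTop ∂μ := by
          refine lintegral_congr_ae ?_
          filter_upwards [hlim] with x hx
          exact ((ENNReal.tendsto_ofReal hx).liminf_eq).symm
      _ ≤ liminf (fun n => ∫⁻ x, ENNReal.ofReal (F n x) ∂μ) atTop :=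
          lintegral_liminf_le' fun n => (hF n).1.aemeasurable.ennreal_ofReal
      _ ≤ liminf (fun n => ENNReal.ofReal (c n)) atTop := by
          refine liminf_le_liminf (Eventually.of_forall fun n => ?_)
          rw [← ofReal_integral_eq_lintegral_ofReal (hF n) (h0 n)]
          exact ENNReal.ofReal_le_ofReal (hc n)
      _ = ENNReal.ofReal L := (ENNReal.tendsto_ofReal hL).liminf_eq
  have hL0 : 0 ≤ L := ge_of_tendsto' hL fun n => (integral_nonneg_of_ae (h0 n)).trans (hc n)
  have hi : Integrable f μ := by
    refine ⟨hfm, ?_⟩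
    rw [hasFiniteIntegral_iff_ofReal hf0]
    exact hfat.trans_lt ENNReal.ofReal_lt_top
  refine ⟨hi, ?_⟩
  rwa [← ofReal_integral_eq_lintegral_ofReal hi hf0, ENNReal.ofReal_le_ofReal_iff hL0] at hfat

/-- A function `u > 0` in `H¹(ℝ³)` with gradient `g` and Laplacian `f ∈ L²`, `f ≤ C u`, such that
`u⁻²` is locally integrable. -/
structure IsPositiveProfile (u : R3 → ℝ) (g : Fin 3 → R3 → ℝ) (f : R3 → ℝ) (C : ℝ) : Prop where
  hasL2Gradient : HasL2Gradient u g
  hasWeakDivergence : HasWeakDivergence g f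
  pos : ∀ᵐ x, 0 < u x
  memLp : MemLp f 2
  nonneg_const : 0 ≤ C
  le_const_mul : ∀ᵐ x, f x ≤ C * u x
  locallyIntegrable_inv_sq : LocallyIntegrable fun x => (u x ^ 2)⁻¹

/-- The half line is preserved by mollification because the kernel is nonnegative, and the shift by
`ε` keeps the inverse smooth there. The constant is a sum so as to bound both the function and its
derivative. -/
lemma isBoundedC1Along_inv {u : R3 → ℝ} (hu : ∀ᵐ x, 0 ≤ u x) {ε : ℝ} (hε : 0 < ε) :
    IsBoundedC1Along u (fun t => (t + ε)⁻¹) (fun t => -((t + ε) ^ 2)⁻¹) (ε⁻¹ + (ε ^ 2)⁻¹)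
      (Set.Ici 0) where
  hasDerivAt t ht := by
    have h0 : t + ε ≠ 0 := by have : 0 ≤ t := ht; positivity
    simpa [neg_div] using ((hasDerivAt_id t).add_const ε).fun_inv h0
  continuousOn := by
    refine ContinuousOn.neg (ContinuousOn.inv₀ (by fun_prop) fun t ht => ?_)
    have : 0 ≤ t := ht
    positivity
  abs_le t ht := by
    have h0 : 0 ≤ t := ht
    rw [abs_of_nonneg (by positivity)]
    have : (t + ε)⁻¹ ≤ ε⁻¹ := inv_anti₀ hε (by linarith)
    have : 0 ≤ (ε ^ 2)⁻¹ := by positivity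
    linarith
  abs_deriv_le t ht := by
    have h0 : 0 ≤ t := ht
    rw [abs_neg, abs_of_nonneg (by positivity)]
    have : ((t + ε) ^ 2)⁻¹ ≤ (ε ^ 2)⁻¹ := by gcongr; linarith
    have : 0 ≤ ε⁻¹ := by positivity
    linarith
  mollify_mem n x := mollify_nonneg hu n x
  ae_mem := hu

lemma IsTest.memLp {η : R3 → ℝ} (hη : IsTest η) : MemLp η 2 :=
  hη.1.continuous.memLp_of_hasCompactSupport hη.2

lemma IsTest.sq {η : R3 → ℝ} (hη : IsTest η) : IsTest fun x => η x ^ 2 := by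
  simpa only [pow_two] using IsTest.mul_left hη.1 hη

lemma _root_.MeasureTheory.MemLp.bdd_mul_two {f q : R3 → ℝ} {K : ℝ} (hf : MemLp f 2)
    (hq : AEStronglyMeasurable q) (hK : ∀ᵐ x, |q x| ≤ K) : MemLp (fun x => q x * f x) 2 := by
  refine MemLp.of_le_mul (c := K) hf (hq.mul hf.1) ?_
  filter_upwards [hK] with x hx
  rw [norm_mul]
  exact mul_le_mul_of_nonneg_right hx (norm_nonneg _)

/-- The regularized ground state substitution for a test function. -/
lemma IsPositiveProfile.integral_sq_sub {u f : R3 → ℝ} {g : Fin 3 → R3 → ℝ} {C : ℝ}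
    (hu : IsPositiveProfile u g f C) {ψ : R3 → ℝ} (hψ : IsTest ψ) {ε : ℝ} (hε : 0 < ε) :
    (∀ i, Integrable fun x => (partialDeriv i ψ x - ψ x * (g i x * (u x + ε)⁻¹)) ^ 2) ∧
    (Integrable fun x => ψ x ^ 2 * (f x * (u x + ε)⁻¹)) ∧
    ∑ i, ∫ x, (partialDeriv i ψ x - ψ x * (g i x * (u x + ε)⁻¹)) ^ 2
      = (∑ i, ∫ x, partialDeriv i ψ x ^ 2) + (∫ x, ψ x ^ 2 * (f x * (u x + ε)⁻¹)) := by
  have hu0 : ∀ᵐ x, 0 ≤ u x := hu.pos.mono fun x hx => hx.le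
  have hF := isBoundedC1Along_inv hu0 hε
  -- Testing `div(∇u / (u + ε)) = f / (u + ε) - |∇u|² / (u + ε)²` against `ψ²` gives exactly the
  -- cross term and the quadratic term of the expanded square.
  have key := hu.hasL2Gradient.integral_test_comp hu.hasWeakDivergence hF hψ.sq
  obtain ⟨B, hB⟩ := hψ.2.exists_bound_of_continuous hψ.1.continuous
  have hqm := hF.aestronglyMeasurable hu.hasL2Gradient.memLp.locallyIntegrable_two
  have hqb : ∀ᵐ x, |(u x + ε)⁻¹ * ψ x| ≤ (ε⁻¹ + (ε ^ 2)⁻¹) * B := by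
    filter_upwards [hu0] with x hx
    rw [abs_mul]
    exact mul_le_mul (hF.abs_le _ hx) (hB x) (abs_nonneg _) hF.nonneg
  have hG := fun i => (hψ.partialDeriv i).memLp
  have hgq : ∀ i, MemLp (fun x => (u x + ε)⁻¹ * ψ x * g i x) 2 := fun i =>
    (hu.hasL2Gradient.memLp_grad i).bdd_mul_two (hqm.mul hψ.1.continuous.aestronglyMeasurable) hqb
  have hfq : MemLp (fun x => (u x + ε)⁻¹ * ψ x * f x) 2 :=
    hu.memLp.bdd_mul_two (hqm.mul hψ.1.continuous.aestronglyMeasurable) hqb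
  have e : ∀ i, (fun x => (partialDeriv i ψ x - ψ x * (g i x * (u x + ε)⁻¹)) ^ 2)
      = fun x => partialDeriv i ψ x ^ 2 - 2 * (partialDeriv i ψ x * ((u x + ε)⁻¹ * ψ x * g i x))
        + ((u x + ε)⁻¹ * ψ x * g i x) ^ 2 := fun i => by ext x; ring
  have i1 := fun i => (hG i).integrable_sq
  have i2 : ∀ i, Integrable fun x =>
      2 * (partialDeriv i ψ x * ((u x + ε)⁻¹ * ψ x * g i x)) :=
    fun i => ((hG i).integrable_mul (hgq i)).const_mul 2
  have i3 := fun i => (hgq i).integrable_sq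
  have i12 : ∀ i, Integrable fun x => partialDeriv i ψ x ^ 2
      - 2 * (partialDeriv i ψ x * ((u x + ε)⁻¹ * ψ x * g i x)) := fun i => (i1 i).sub (i2 i)
  refine ⟨fun i => ?_, ?_, ?_⟩
  · rw [e]; exact (i12 i).add (i3 i)
  · refine (hψ.memLp.integrable_mul hfq).congr (Eventually.of_forall fun x => ?_)
    simp only [Pi.mul_apply]; ring
  · have e2 : ∀ i, ∫ x, (partialDeriv i ψ x - ψ x * (g i x * (u x + ε)⁻¹)) ^ 2
        = (∫ x, partialDeriv i ψ x ^ 2)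
          - (∫ x, partialDeriv i (fun y => ψ y ^ 2) x * (g i x * (u x + ε)⁻¹))
          - ∫ x, ψ x ^ 2 * (-((u x + ε) ^ 2)⁻¹ * g i x ^ 2) := by
      intro i
      rw [e, integral_add (i12 i) (i3 i), integral_sub (i1 i) (i2 i), sub_eq_add_neg _
        (∫ x, ψ x ^ 2 * (-((u x + ε) ^ 2)⁻¹ * g i x ^ 2)), ← integral_neg]
      congr 2
      · congr 1; ext x
        have := partialDeriv_mul hψ.1 hψ.1 i x
        simp only [← pow_two] at this
        rw [this]; ring
      · ext x; rw [← inv_pow]; ring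
    simp only [e2, Finset.sum_sub_distrib]
    linarith

/-- The density `|∇ψ - ψ ∇u / u|² + w₋ ψ²`, with `w = f / u`. -/
def lowerDensity (u : R3 → ℝ) (g : Fin 3 → R3 → ℝ) (f ψ : R3 → ℝ) (G : Fin 3 → R3 → ℝ)
    (x : R3) : ℝ :=
  (∑ i, (G i x - ψ x * (g i x / u x)) ^ 2) + max (-(f x / u x)) 0 * ψ x ^ 2

/-- The density `|∇ψ|² + w₊ ψ²`, with `w = f / u`. -/
def upperDensity (u f ψ : R3 → ℝ) (G : Fin 3 → R3 → ℝ) (x : R3) : ℝ :=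
  (∑ i, G i x ^ 2) + max (f x / u x) 0 * ψ x ^ 2

section

variable {u f ψ : R3 → ℝ} {g G : Fin 3 → R3 → ℝ} {C : ℝ}

lemma IsPositiveProfile.aestronglyMeasurable_div (hu : IsPositiveProfile u g f C) :
    AEStronglyMeasurable fun x => f x / u x :=
  (hu.memLp.1.aemeasurable.div hu.hasL2Gradient.memLp.1.aemeasurable).aestronglyMeasurable

lemma IsPositiveProfile.div_le (hu : IsPositiveProfile u g f C) :
    ∀ᵐ x, max (f x / u x) 0 ≤ C := by
  filter_upwards [hu.pos, hu.le_const_mul] with x h1 h2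
  exact max_le ((div_le_iff₀ h1).2 h2) hu.nonneg_const

lemma IsPositiveProfile.integrable_max_mul_sq (hu : IsPositiveProfile u g f C)
    (hψ : MemLp ψ 2) : Integrable fun x => max (f x / u x) 0 * ψ x ^ 2 := by
  refine (hψ.integrable_sq.const_mul C).mono'
    ((hu.aestronglyMeasurable_div.sup aestronglyMeasurable_const).mul (hψ.1.pow 2)) ?_
  filter_upwards [hu.div_le] with x hx
  rw [Real.norm_of_nonneg (mul_nonneg (le_max_right _ _) (sq_nonneg _))]
  exact mul_le_mul_of_nonneg_right hx (sq_nonneg _)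

lemma integrable_sum_sq (hG : ∀ i, MemLp (G i) 2) : Integrable fun x => ∑ i, G i x ^ 2 :=
  integrable_finsetSum _ fun i _ => (hG i).integrable_sq

lemma IsPositiveProfile.integrable_upperDensity (hu : IsPositiveProfile u g f C)
    (hψ : MemLp ψ 2) (hG : ∀ i, MemLp (G i) 2) : Integrable (upperDensity u f ψ G) :=
  (integrable_sum_sq hG).add (hu.integrable_max_mul_sq hψ)

lemma lowerDensity_nonneg (x : R3) : 0 ≤ lowerDensity u g f ψ G x :=
  add_nonneg (Finset.sum_nonneg fun _ _ => sq_nonneg _)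
    (mul_nonneg (le_max_right _ _) (sq_nonneg _))

/-- This is the limit `ε → 0` of the regularized substitution. The negative part of `f / (u + ε)` is
moved to the left, where Fatou needs no domination; on the right only the positive part remains, and
it increases to that of `f / u`, giving a bound independent of `ε`. -/
lemma IsPositiveProfile.integral_lowerDensity_le_of_isTest (hu : IsPositiveProfile u g f C)
    (hψ : IsTest ψ) :
    Integrable (lowerDensity u g f ψ fun i => partialDeriv i ψ) ∧
    ∫ x, lowerDensity u g f ψ (fun i => partialDeriv i ψ) x
      ≤ ∫ x, upperDensity u f ψ (fun i => partialDeriv i ψ) x := by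
  set ε : ℕ → ℝ := fun n => 1 / ((n : ℝ) + 1) with hεdef
  have hε : ∀ n, 0 < ε n := fun n => by positivity
  have hεlim : Tendsto ε atTop (𝓝 0) := tendsto_one_div_add_atTop_nhds_zero_nat
  have hA := fun n => hu.integral_sq_sub hψ (hε n)
  have hmax : ∀ a b : ℝ, max (-a) 0 * b ^ 2 = max (-(b ^ 2 * a)) 0 := fun a b => by
    rw [max_mul_of_nonneg _ _ (sq_nonneg b), zero_mul]; congr 1; ring
  have iN : ∀ n, Integrable fun x => max (-(f x * (u x + ε n)⁻¹)) 0 * ψ x ^ 2 := fun n => by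
    simp only [hmax]
    exact (hA n).2.1.neg.pos_part
  have iS : ∀ n, Integrable fun x =>
      ∑ i, (partialDeriv i ψ x - ψ x * (g i x * (u x + ε n)⁻¹)) ^ 2 := fun n =>
    integrable_finsetSum _ fun i _ => (hA n).1 i
  have hG := fun i => (hψ.partialDeriv i).memLp
  refine integrable_and_integral_le_of_tendsto
    (F := fun n x => (∑ i, (partialDeriv i ψ x - ψ x * (g i x * (u x + ε n)⁻¹)) ^ 2)
      + max (-(f x * (u x + ε n)⁻¹)) 0 * ψ x ^ 2)
    (c := fun _ => ∫ x, upperDensity u f ψ (fun i => partialDeriv i ψ) x)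
    (fun n => (iS n).add (iN n)) (fun n => Eventually.of_forall fun x => ?_) ?_ (fun n => ?_)
    tendsto_const_nhds
  · exact add_nonneg (Finset.sum_nonneg fun _ _ => sq_nonneg _)
      (mul_nonneg (le_max_right _ _) (sq_nonneg _))
  · filter_upwards [hu.pos] with x hx
    have h1 : Tendsto (fun n => (u x + ε n)⁻¹) atTop (𝓝 (u x)⁻¹) := by
      have : Tendsto (fun n => u x + ε n) atTop (𝓝 (u x)) := by
        simpa using hεlim.const_add (u x)
      exact this.inv₀ hx.ne'
    simp only [lowerDensity, div_eq_mul_inv]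
    refine Tendsto.add (tendsto_finsetSum _ fun i _ => ?_) ?_
    · exact ((((h1.const_mul _).const_mul _).const_sub _).pow 2)
    · exact (((h1.const_mul _).neg).max tendsto_const_nhds).mul_const _
  · have iC : Integrable fun x => ψ x ^ 2 * (f x * (u x + ε n)⁻¹)
        + max (-(f x * (u x + ε n)⁻¹)) 0 * ψ x ^ 2 := (hA n).2.1.add (iN n)
    rw [integral_add (iS n) (iN n), integral_finsetSum _ fun i _ => (hA n).1 i, (hA n).2.2,
      ← integral_finsetSum _ fun i _ => (hG i).integrable_sq, add_assoc,
      ← integral_add (hA n).2.1 (iN n), ← integral_add (integrable_sum_sq hG) iC]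
    refine integral_mono_ae ((integrable_sum_sq hG).add iC)
      (hu.integrable_upperDensity hψ.memLp hG) ?_
    filter_upwards [hu.pos] with x hx
    simp only [upperDensity]
    gcongr
    have h1 : ψ x ^ 2 * (f x * (u x + ε n)⁻¹) + max (-(f x * (u x + ε n)⁻¹)) 0 * ψ x ^ 2
        = max (f x * (u x + ε n)⁻¹) 0 * ψ x ^ 2 := by
      rcases le_total (f x * (u x + ε n)⁻¹) 0 with h | h
      · rw [max_eq_left (by linarith), max_eq_right h]; ring
      · rw [max_eq_right (by linarith), max_eq_left h]; ring
    rw [h1]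
    refine mul_le_mul_of_nonneg_right ?_ (sq_nonneg _)
    have h2 : (u x + ε n)⁻¹ ≤ (u x)⁻¹ := inv_anti₀ hx (by linarith [hε n])
    have h3 : 0 ≤ (u x + ε n)⁻¹ := by have := hε n; positivity
    rw [div_eq_mul_inv]
    rcases le_total (f x) 0 with h | h
    · rw [max_eq_right (mul_nonpos_of_nonpos_of_nonneg h h3)]
      exact le_max_right _ _
    · exact max_le_max_right 0 (mul_le_mul_of_nonneg_left h2 h)

lemma mollify_sum_sq_le (hψ : MemLp ψ 2) (hG : ∀ i, MemLp (G i) 2) (n : ℕ) (x : R3) :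
    mollify n ψ x ^ 2 + ∑ i, mollify n (G i) x ^ 2
      ≤ mollify n (fun y => ψ y ^ 2 + ∑ i, G i y ^ 2) x := by
  have i0 : LocallyIntegrable fun x => ψ x ^ 2 := hψ.integrable_sq.locallyIntegrable
  have i1 : ∀ i, LocallyIntegrable fun x => G i x ^ 2 := fun i =>
    (hG i).integrable_sq.locallyIntegrable
  have iS : LocallyIntegrable fun x => ∑ i, G i x ^ 2 := (integrable_sum_sq hG).locallyIntegrable
  have iT : LocallyIntegrable fun x => G 0 x ^ 2 + G 1 x ^ 2 :=
    ((hG 0).integrable_sq.add (hG 1).integrable_sq).locallyIntegrable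
  rw [mollify_add i0 iS]
  simp only [Fin.sum_univ_three]
  rw [mollify_add iT (i1 2), mollify_add (i1 0) (i1 1)]
  have h := fun i => mollify_sq_le (hG i).locallyIntegrable_two (i1 i) n x
  have h' := mollify_sq_le hψ.locallyIntegrable_two i0 n x
  linarith [h 0, h 1, h 2]

/-- The energy inequality: `∫ |∇ψ - ψ ∇u / u|² + ∫ w₋ ψ² ≤ ∫ |∇ψ|² + ∫ w₊ ψ²` for real `ψ ∈ H¹`,
where `w = Δu / u`. -/
lemma IsPositiveProfile.integral_lowerDensity_le (hu : IsPositiveProfile u g f C)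
    (hψ : HasL2Gradient ψ G) :
    Integrable (lowerDensity u g f ψ G) ∧
    ∫ x, lowerDensity u g f ψ G x ≤ ∫ x, upperDensity u f ψ G x := by
  obtain ⟨M, hM0, hM⟩ := exists_abs_partialDeriv_cutoff_le
  have hψl := hψ.memLp.locallyIntegrable_two
  have hGl := fun i => (hψ.memLp_grad i).locallyIntegrable_two
  -- Mollifying and cutting off gives test functions that converge to `ψ` a.e. together with their
  -- gradients. Fatou applies to the lower density; the upper density converges in the integral.
  set p : ℕ → R3 → ℝ := fun n x => mollify n ψ x * cutoff n x with hp
  have hpt : ∀ n, IsTest (p n) := fun n =>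
    IsTest.mul_left (contDiff_mollify hψl n) (isTest_cutoff n)
  have hpd : ∀ n i x, partialDeriv i (p n) x = mollify n (G i) x * cutoff n x
      + mollify n ψ x * partialDeriv i (cutoff n) x := fun n i x => by
    rw [hp, partialDeriv_mul (contDiff_mollify hψl n) (isTest_cutoff n).1,
      (hψ.hasWeakPartial i).partialDeriv_mollify]
  have hdlim : ∀ i x, Tendsto (fun n => partialDeriv i (cutoff n) x) atTop (𝓝 0) := fun i x => by
    refine squeeze_zero_norm (fun n => hM n i x) ?_
    simpa using (tendsto_one_div_add_atTop_nhds_zero_nat (𝕜 := ℝ)).const_mul M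
  have hlim : ∀ᵐ x, Tendsto (fun n => p n x) atTop (𝓝 (ψ x)) := by
    filter_upwards [ae_tendsto_mollify hψl] with x h1
    simpa using h1.mul (tendsto_cutoff x)
  have hlimd : ∀ᵐ x, ∀ i, Tendsto (fun n => partialDeriv i (p n) x) atTop (𝓝 (G i x)) := by
    filter_upwards [ae_tendsto_mollify hψl, ae_all_iff.2 fun i => ae_tendsto_mollify (hGl i)]
      with x h1 h2 i
    simp only [hpd]
    simpa using ((h2 i).mul (tendsto_cutoff x)).add (h1.mul (hdlim i x))
  have hB := fun n => hu.integral_lowerDensity_le_of_isTest (hpt n)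
  -- Each of the three squared derivatives contributes `2 * M ^ 2` from the cutoff and the factor 2
  -- on `G i ^ 2`; `C` bounds the positive part of the potential.
  set K : ℝ := 6 * M ^ 2 + C + 2 with hK
  have hb : Integrable fun x => ψ x ^ 2 + ∑ i, G i x ^ 2 :=
    hψ.memLp.integrable_sq.add (integrable_sum_sq hψ.memLp_grad)
  refine integrable_and_integral_le_of_tendsto (fun n => (hB n).1)
    (fun n => Eventually.of_forall fun x => lowerDensity_nonneg x) ?_ (fun n => (hB n).2) ?_
  · filter_upwards [hlim, hlimd] with x h1 h2
    exact (tendsto_finsetSum _ fun i _ => ((h2 i).sub (h1.mul_const _)).pow 2).add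
      ((h1.pow 2).const_mul _)
  · refine tendsto_integral_of_tendsto_bound
      (B := fun n x => K * mollify n (fun x => ψ x ^ 2 + ∑ i, G i x ^ 2) x)
      (b := fun x => K * (ψ x ^ 2 + ∑ i, G i x ^ 2))
      (fun n => (hu.integrable_upperDensity (hpt n).memLp
        fun i => ((hpt n).partialDeriv i).memLp).1)
      (fun n => (integrable_mollify hb n).const_mul K) (hb.const_mul K) (fun n => ?_) ?_ ?_ ?_
    · filter_upwards [hu.div_le] with x hx
      have hc0 := cutoff_nonneg n x
      have hc1 := cutoff_le_one n x
      have hc2 : cutoff n x ^ 2 ≤ 1 := pow_le_one₀ hc0 hc1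
      have h1 : ∀ i, partialDeriv i (p n) x ^ 2
          ≤ 2 * mollify n (G i) x ^ 2 + 2 * M ^ 2 * mollify n ψ x ^ 2 := by
        intro i
        have h3 : |partialDeriv i (cutoff n) x| ≤ M := by
          refine (hM n i x).trans (mul_le_of_le_one_right hM0 ?_)
          rw [div_le_one (by positivity)]
          linarith [n.cast_nonneg (α := ℝ)]
        have h4 : partialDeriv i (cutoff n) x ^ 2 ≤ M ^ 2 :=
          sq_le_sq' (abs_le.1 h3).1 (abs_le.1 h3).2
        rw [hpd]
        have h5 := add_sq_le (a := mollify n (G i) x * cutoff n x)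
          (b := mollify n ψ x * partialDeriv i (cutoff n) x)
        have h6 : (mollify n (G i) x * cutoff n x) ^ 2 ≤ mollify n (G i) x ^ 2 := by
          rw [mul_pow]; exact mul_le_of_le_one_right (sq_nonneg _) hc2
        have h7 : (mollify n ψ x * partialDeriv i (cutoff n) x) ^ 2
            ≤ mollify n ψ x ^ 2 * M ^ 2 := by
          rw [mul_pow]; exact mul_le_mul_of_nonneg_left h4 (sq_nonneg _)
        linarith
      have h2 : max (f x / u x) 0 * p n x ^ 2 ≤ C * mollify n ψ x ^ 2 := by
        refine mul_le_mul hx ?_ (sq_nonneg _) hu.nonneg_const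
        rw [hp]; dsimp only
        rw [mul_pow]; exact mul_le_of_le_one_right (sq_nonneg _) hc2
      have h0 : 0 ≤ upperDensity u f (p n) (fun i => partialDeriv i (p n)) x :=
        add_nonneg (Finset.sum_nonneg fun _ _ => sq_nonneg _)
          (mul_nonneg (le_max_right _ _) (sq_nonneg _))
      rw [abs_of_nonneg h0]
      have hK2 : 2 ≤ K := by have := hu.nonneg_const; have := sq_nonneg M; linarith
      refine le_trans ?_ (mul_le_mul_of_nonneg_left
        (mollify_sum_sq_le hψ.memLp hψ.memLp_grad n x) (by linarith : 0 ≤ K))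
      simp only [upperDensity, Fin.sum_univ_three]
      have s0 := mul_le_mul_of_nonneg_right hK2 (sq_nonneg (mollify n (G 0) x))
      have s1 := mul_le_mul_of_nonneg_right hK2 (sq_nonneg (mollify n (G 1) x))
      have s2 := mul_le_mul_of_nonneg_right hK2 (sq_nonneg (mollify n (G 2) x))
      have s3 : K * mollify n ψ x ^ 2 = 6 * M ^ 2 * mollify n ψ x ^ 2 + C * mollify n ψ x ^ 2
        + 2 * mollify n ψ x ^ 2 := by rw [hK]; ring
      linarith [h1 0, h1 1, h1 2, sq_nonneg (mollify n ψ x)]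
    · filter_upwards [hlim, hlimd] with x h1 h2
      exact (tendsto_finsetSum _ fun i _ => (h2 i).pow 2).add ((h1.pow 2).const_mul _)
    · filter_upwards [ae_tendsto_mollify hb.locallyIntegrable] with x hx using hx.const_mul K
    · simp only [integral_const_mul, integral_mollify hb]
      exact tendsto_const_nhds

end

/-! ### Solutions and the case of equality -/

/-- A bounded smooth substitute for the identity, which it approaches as `δ → 0`. The condition `δ ≤
1` lets `δ⁻¹ ≥ 1` bound the derivative as well. -/
lemma isBoundedC1Along_div {φ : R3 → ℝ} {δ : ℝ} (hδ : 0 < δ) (hδ1 : δ ≤ 1) :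
    IsBoundedC1Along φ (fun t => t / (1 + δ * t ^ 2))
      (fun t => (1 - δ * t ^ 2) / (1 + δ * t ^ 2) ^ 2) δ⁻¹ Set.univ where
  hasDerivAt t _ := by
    have h0 : 1 + δ * t ^ 2 ≠ 0 := by positivity
    have h := (hasDerivAt_id t).fun_div
      ((((hasDerivAt_id t).fun_pow 2).const_mul δ).const_add 1) h0
    refine h.congr_deriv ?_
    simp only [id, Nat.cast_ofNat, Nat.add_one_sub_one, pow_one, mul_one, one_mul]
    ring
  continuousOn := by
    refine Continuous.continuousOn (Continuous.div (by fun_prop) (by fun_prop) fun t => ?_)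
    positivity
  abs_le t _ := by
    have h0 : 0 < 1 + δ * t ^ 2 := by positivity
    rw [abs_div, abs_of_pos h0, div_le_iff₀ h0]
    have h1 : δ⁻¹ * (1 + δ * t ^ 2) = δ⁻¹ + t ^ 2 := by field_simp
    have h2 : 1 ≤ δ⁻¹ := (one_le_inv₀ hδ).2 hδ1
    rw [h1, ← sq_abs t]
    nlinarith [sq_nonneg (|t| - 1), abs_nonneg t]
  abs_deriv_le t _ := by
    have h0 : 0 ≤ δ * t ^ 2 := by positivity
    have h2 : 1 ≤ δ⁻¹ := (one_le_inv₀ hδ).2 hδ1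
    refine le_trans ?_ h2
    rw [abs_div, abs_of_pos (by positivity : 0 < (1 + δ * t ^ 2) ^ 2), div_le_one (by positivity),
      abs_le]
    constructor <;> nlinarith
  mollify_mem _ _ := Set.mem_univ _
  ae_mem := Eventually.of_forall fun _ => Set.mem_univ _

/-- A function may be used as a test function in the weak equation for its own Laplacian `T`,
provided that `T φ` is integrable. -/
lemma HasL2Gradient.integral_grad_sq_eq {φ T : R3 → ℝ} {g : Fin 3 → R3 → ℝ}
    (hφ : HasL2Gradient φ g) (hT : HasWeakDivergence g T) (hTφ : Integrable fun x => T x * φ x) :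
    ∫ x, ∑ i, g i x ^ 2 = -∫ x, T x * φ x := by
  obtain ⟨M, hM0, hM⟩ := exists_abs_partialDeriv_cutoff_le
  have hφl := hφ.memLp.locallyIntegrable_two
  set δ : ℕ → ℝ := fun n => 1 / ((n : ℝ) + 1) with hδdef
  have hδ : ∀ n, 0 < δ n := fun n => by positivity
  have hδ1 : ∀ n, δ n ≤ 1 := fun n => by
    rw [hδdef]; dsimp only
    rw [div_le_one (by positivity)]
    linarith [n.cast_nonneg (α := ℝ)]
  have hδlim : Tendsto δ atTop (𝓝 0) := tendsto_one_div_add_atTop_nhds_zero_nat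
  have hF := fun n => isBoundedC1Along_div (φ := φ) (hδ n) (hδ1 n)
  -- The effective test function is `cutoff n * φ / (1 + δ n * φ ^ 2)`. It is dominated by `|φ|`,
  -- and so integrability of `T φ` suffices; the terms with the gradient of the cutoff are `O(1 /
  -- n)` because `g i * φ` is integrable.
  have key := fun n => hφ.integral_test_comp hT (hF n) (isTest_cutoff n)
  have hFm := fun n => (hF n).aestronglyMeasurable hφl
  have hFm' := fun n => (hF n).aestronglyMeasurable_deriv hφl
  have hχm := fun n => (isTest_cutoff n).1.continuous.aestronglyMeasurable (μ := volume)
  have hden : ∀ t : ℝ, Tendsto (fun n => 1 + δ n * t ^ 2) atTop (𝓝 1) := fun t => by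
    simpa using (hδlim.mul_const (t ^ 2)).const_add 1
  have hFlim : ∀ t : ℝ, Tendsto (fun n => t / (1 + δ n * t ^ 2)) atTop (𝓝 t) := fun t => by
    have h1 : Tendsto (fun n => t / (1 + δ n * t ^ 2)) atTop (𝓝 (t / 1)) :=
      tendsto_const_nhds.div (hden t) one_ne_zero
    rwa [div_one] at h1
  have hFlim' : ∀ t : ℝ, Tendsto (fun n => (1 - δ n * t ^ 2) / (1 + δ n * t ^ 2) ^ 2) atTop
      (𝓝 1) := fun t => by
    have h1 : Tendsto (fun n => 1 - δ n * t ^ 2) atTop (𝓝 1) := by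
      simpa using (hδlim.mul_const (t ^ 2)).const_sub 1
    have h2 : Tendsto (fun n => (1 - δ n * t ^ 2) / (1 + δ n * t ^ 2) ^ 2) atTop
        (𝓝 (1 / 1 ^ 2)) := h1.div ((hden t).pow 2) (by norm_num)
    rwa [one_pow, div_one] at h2
  have hFle : ∀ n (t : ℝ), |t / (1 + δ n * t ^ 2)| ≤ |t| := fun n t => by
    have h0 : 0 ≤ δ n * t ^ 2 := mul_nonneg (hδ n).le (sq_nonneg _)
    rw [abs_div, abs_of_nonneg (by linarith : 0 ≤ 1 + δ n * t ^ 2)]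
    exact div_le_self (abs_nonneg _) (by linarith)
  have hFle' : ∀ n (t : ℝ), |(1 - δ n * t ^ 2) / (1 + δ n * t ^ 2) ^ 2| ≤ 1 := fun n t => by
    have h0 : 0 ≤ δ n * t ^ 2 := mul_nonneg (hδ n).le (sq_nonneg _)
    rw [abs_div, abs_of_pos (by positivity : 0 < (1 + δ n * t ^ 2) ^ 2),
      div_le_one (by positivity), abs_le]
    constructor <;> nlinarith
  have hχa : ∀ n x, |cutoff n x| ≤ 1 := fun n x => by
    rw [abs_of_nonneg (cutoff_nonneg n x)]; exact cutoff_le_one n x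
  have l1 : ∀ i, Tendsto (fun n => ∫ x, cutoff n x *
      ((1 - δ n * φ x ^ 2) / (1 + δ n * φ x ^ 2) ^ 2 * g i x ^ 2)) atTop
      (𝓝 (∫ x, g i x ^ 2)) := by
    intro i
    refine tendsto_integral_of_dominated_convergence (fun x => g i x ^ 2)
      (fun n => (hχm n).mul ((hFm' n).mul ((hφ.memLp_grad i).1.pow 2)))
      (hφ.memLp_grad i).integrable_sq (fun n => Eventually.of_forall fun x => ?_)
      (Eventually.of_forall fun x => ?_)
    · rw [Real.norm_eq_abs, abs_mul, abs_mul, abs_of_nonneg (sq_nonneg (g i x)), ← mul_assoc]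
      exact mul_le_of_le_one_left (sq_nonneg _)
        (mul_le_one₀ (hχa n x) (abs_nonneg _) (hFle' n _))
    · simpa using (tendsto_cutoff x).mul ((hFlim' (φ x)).mul_const (g i x ^ 2))
  have l2 : Tendsto (fun n => ∫ x, cutoff n x * (T x * (φ x / (1 + δ n * φ x ^ 2)))) atTop
      (𝓝 (∫ x, T x * φ x)) := by
    refine tendsto_integral_of_dominated_convergence (fun x => |T x * φ x|)
      (fun n => (hχm n).mul (hT.locallyIntegrable_divergence.aestronglyMeasurable.mul (hFm n)))
      hTφ.abs (fun n => Eventually.of_forall fun x => ?_) (Eventually.of_forall fun x => ?_)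
    · rw [Real.norm_eq_abs, abs_mul, abs_mul, abs_mul]
      refine (mul_le_of_le_one_left (by positivity) (hχa n x)).trans ?_
      exact mul_le_mul_of_nonneg_left (hFle n _) (abs_nonneg _)
    · simpa using (tendsto_cutoff x).mul ((hFlim (φ x)).const_mul (T x))
  have l3 : ∀ i, Tendsto (fun n => ∫ x, partialDeriv i (cutoff n) x *
      (g i x * (φ x / (1 + δ n * φ x ^ 2)))) atTop (𝓝 0) := by
    intro i
    have hi : Integrable fun x => |g i x * φ x| :=
      ((hφ.memLp_grad i).integrable_mul hφ.memLp).abs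
    have h0 : Tendsto (fun n : ℕ => ∫ x, M * (1 / ((n : ℝ) + 1)) * |g i x * φ x|) atTop
        (𝓝 0) := by
      simp only [integral_const_mul]
      simpa using ((tendsto_one_div_add_atTop_nhds_zero_nat (𝕜 := ℝ)).const_mul M).mul_const
        (∫ x, |g i x * φ x|)
    refine squeeze_zero_norm (fun n => ?_) h0
    refine norm_integral_le_of_norm_le (hi.const_mul _) (Eventually.of_forall fun x => ?_)
    rw [Real.norm_eq_abs, abs_mul, abs_mul, abs_mul]
    refine mul_le_mul (hM n i x) ?_ (by positivity) ((abs_nonneg _).trans (hM n i x))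
    exact mul_le_mul_of_nonneg_left (hFle n _) (abs_nonneg _)
  have hlim := tendsto_nhds_unique
    (((tendsto_finsetSum Finset.univ fun i _ => l1 i).add l2).congr key)
    (tendsto_finsetSum Finset.univ fun i _ => l3 i).neg
  rw [integral_finsetSum _ fun i _ => (hφ.memLp_grad i).integrable_sq]
  simp only [Finset.sum_const_zero, neg_zero] at hlim
  linarith

/-- A function with vanishing weak gradient is constant. -/
lemma exists_ae_eq_const {h : R3 → ℝ} (hh : ∀ i, HasWeakPartial i h 0) :
    ∃ c : ℝ, ∀ᵐ x, h x = c := by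
  have hl := (hh 0).locallyIntegrable
  -- The mollifications are smooth with zero derivative. One point of convergence then determines
  -- the limit almost everywhere.
  have hc : ∀ n x, mollify n h x = mollify n h 0 := by
    intro n x
    refine is_const_of_fderiv_eq_zero (𝕜 := ℝ)
      ((contDiff_mollify hl n).differentiable (by simp)) (fun y => ?_) x 0
    have h0 : ∀ i, fderiv ℝ (mollify n h) y (EuclideanSpace.single i 1) = 0 := fun i => by
      have := (hh i).partialDeriv_mollify n y
      rw [mollify_apply n 0] at this
      simpa [partialDeriv] using this
    refine ContinuousLinearMap.coe_injective
      ((EuclideanSpace.basisFun (Fin 3) ℝ).toBasis.ext fun i => ?_)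
    simpa using h0 i
  have hlim := ae_tendsto_mollify hl
  obtain ⟨x₀, hx₀⟩ := hlim.exists
  refine ⟨h x₀, ?_⟩
  filter_upwards [hlim] with x hx
  refine tendsto_nhds_unique hx (hx₀.congr fun n => ?_)
  rw [hc n x₀, hc n x]

/-- From `|p / u| ≤ p² + u⁻²`. It serves both for the potential `f / u` and for the quotient `ψ /
u`. -/
lemma IsPositiveProfile.locallyIntegrable_div {u f p : R3 → ℝ} {g : Fin 3 → R3 → ℝ} {C : ℝ}
    (hu : IsPositiveProfile u g f C) (hp : MemLp p 2) :
    LocallyIntegrable fun x => p x / u x := by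
  have h1 : LocallyIntegrable fun x => p x ^ 2 + (u x ^ 2)⁻¹ :=
    hp.integrable_sq.locallyIntegrable.add hu.locallyIntegrable_inv_sq
  refine h1.mono
    (hp.1.aemeasurable.div hu.hasL2Gradient.memLp.1.aemeasurable).aestronglyMeasurable
    (Eventually.of_forall fun x => ?_)
  rw [Real.norm_of_nonneg (by positivity : 0 ≤ p x ^ 2 + (u x ^ 2)⁻¹), Real.norm_eq_abs,
    div_eq_mul_inv, abs_mul, ← inv_pow, ← sq_abs (p x), ← sq_abs (u x)⁻¹]
  linarith [two_mul_le_add_sq |p x| |(u x)⁻¹|,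
    mul_nonneg (abs_nonneg (p x)) (abs_nonneg (u x)⁻¹)]

/-- The hypothesis `hG` says that the formal gradient of `ψ / u` is zero. The quotient rule is
available for `ψ / (u + ε)`, and letting `ε → 0` shows that the weak gradient of `ψ / u` vanishes.
-/
lemma IsPositiveProfile.exists_ae_eq_const_mul {u f ψ : R3 → ℝ} {g G : Fin 3 → R3 → ℝ} {C : ℝ}
    (hu : IsPositiveProfile u g f C) (hψ : HasL2Gradient ψ G)
    (hG : ∀ᵐ x, ∀ i, G i x = ψ x * (g i x / u x)) : ∃ c : ℝ, ∀ᵐ x, ψ x = c * u x := by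
  have hu0 : ∀ᵐ x, 0 ≤ u x := hu.pos.mono fun x hx => hx.le
  have hloc := fun {p : R3 → ℝ} (hp : MemLp p 2) => hu.locallyIntegrable_div hp
  set ε : ℕ → ℝ := fun n => 1 / ((n : ℝ) + 1) with hεdef
  have hε : ∀ n, 0 < ε n := fun n => by positivity
  have hεlim : Tendsto ε atTop (𝓝 0) := tendsto_one_div_add_atTop_nhds_zero_nat
  have hF := fun n => isBoundedC1Along_inv hu0 (hε n)
  have hul := hu.hasL2Gradient.memLp.locallyIntegrable_two
  have hFm := fun n => (hF n).aestronglyMeasurable hul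
  have hFm' := fun n => (hF n).aestronglyMeasurable_deriv hul
  have hinv : ∀ x, 0 < u x → Tendsto (fun n => (u x + ε n)⁻¹) atTop (𝓝 (u x)⁻¹) := by
    intro x hx
    have : Tendsto (fun n => u x + ε n) atTop (𝓝 (u x)) := by
      simpa using hεlim.const_add (u x)
    exact this.inv₀ hx.ne'
  have hpart : ∀ i, HasWeakPartial i (fun x => ψ x / u x) 0 := by
    refine fun i => ⟨hloc hψ.memLp, locallyIntegrable_zero, fun η hη => ?_⟩
    have key := fun n => hψ.hasWeakPartial_mul_comp hu.hasL2Gradient (hF n) hη i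
    have hηi := hη.partialDeriv i
    have l1 : Tendsto (fun n => ∫ x, η x * (G i x * (u x + ε n)⁻¹
        + ψ x * (-((u x + ε n) ^ 2)⁻¹ * g i x))) atTop (𝓝 (∫ _ : R3, (0 : ℝ))) := by
      refine tendsto_integral_of_dominated_convergence (fun x => |η x| * |G i x / u x|)
        (fun n => hη.1.continuous.aestronglyMeasurable.mul
          (((hψ.memLp_grad i).1.mul (hFm n)).add (hψ.memLp.1.mul
            ((hFm' n).mul (hu.hasL2Gradient.memLp_grad i).1)))) ?_ (fun n => ?_) ?_
      · exact (hloc (hψ.memLp_grad i)).abs.integrable_smul_left_of_hasCompactSupport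
          hη.1.continuous.abs hη.2.abs
      · filter_upwards [hu.pos, hG] with x hx hGx
        have he := hε n
        -- By `hG` the regularized gradient is `G i / u` times a factor in `[0, 1]`, which gives the
        -- locally integrable dominating function `|G i / u|`.
        have h1 : G i x * (u x + ε n)⁻¹ + ψ x * (-((u x + ε n) ^ 2)⁻¹ * g i x)
            = G i x / u x * (u x * ε n / (u x + ε n) ^ 2) := by
          rw [hGx]; field_simp; ring
        have h2 : |u x * ε n / (u x + ε n) ^ 2| ≤ 1 := by
          rw [abs_of_pos (by positivity), div_le_one (by positivity)]
          nlinarith [mul_pos hx he]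
        rw [h1, Real.norm_eq_abs, abs_mul, abs_mul (G i x / u x)]
        exact mul_le_mul_of_nonneg_left (mul_le_of_le_one_right (abs_nonneg _) h2) (abs_nonneg _)
      · filter_upwards [hu.pos, hG] with x hx hGx
        have h1 := ((hinv x hx).const_mul (G i x)).add
          ((((hinv x hx).pow 2).neg.mul_const (g i x)).const_mul (ψ x))
        have h2 := h1.const_mul (η x)
        have h3 : η x * (G i x * (u x)⁻¹ + ψ x * (-(u x)⁻¹ ^ 2 * g i x)) = 0 := by
          rw [hGx]; field_simp; ring
        rw [h3] at h2
        simpa only [inv_pow] using h2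
    have l2 : Tendsto (fun n => ∫ x, partialDeriv i η x * (ψ x * (u x + ε n)⁻¹)) atTop
        (𝓝 (∫ x, partialDeriv i η x * (ψ x / u x))) := by
      refine tendsto_integral_of_dominated_convergence
        (fun x => |partialDeriv i η x| * |ψ x / u x|)
        (fun n => hηi.1.continuous.aestronglyMeasurable.mul (hψ.memLp.1.mul (hFm n)))
        ?_ (fun n => ?_) ?_
      · exact (hloc hψ.memLp).abs.integrable_smul_left_of_hasCompactSupport
          hηi.1.continuous.abs hηi.2.abs
      · filter_upwards [hu.pos] with x hx
        have he := hε n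
        rw [Real.norm_eq_abs, abs_mul, abs_mul, abs_div, div_eq_mul_inv, abs_of_pos hx,
          abs_of_pos (by positivity : 0 < (u x + ε n)⁻¹)]
        gcongr
        linarith
      · filter_upwards [hu.pos] with x hx
        rw [div_eq_mul_inv]
        exact ((hinv x hx).const_mul _).const_mul _
    have h := tendsto_nhds_unique (l1.congr key) l2.neg
    simp only [integral_zero] at h
    simp only [Pi.zero_apply, mul_zero, integral_zero, neg_zero]
    linarith
  obtain ⟨c, hc⟩ := exists_ae_eq_const hpart
  refine ⟨c, ?_⟩
  filter_upwards [hc, hu.pos] with x hx hx0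
  rw [← hx, div_mul_cancel₀ _ hx0.ne']

/-- The energy form controls the defect `|∇ψ - ψ ∇u / u|²`. -/
lemma IsPositiveProfile.integral_defect_le {u f ψ : R3 → ℝ} {g G : Fin 3 → R3 → ℝ} {C : ℝ}
    (hu : IsPositiveProfile u g f C) (hψ : HasL2Gradient ψ G) :
    Integrable (fun x => f x / u x * ψ x ^ 2) ∧
    Integrable (fun x => ∑ i, (G i x - ψ x * (g i x / u x)) ^ 2) ∧
    ∫ x, ∑ i, (G i x - ψ x * (g i x / u x)) ^ 2
      ≤ (∫ x, ∑ i, G i x ^ 2) + (∫ x, f x / u x * ψ x ^ 2) := by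
  obtain ⟨h1, h2⟩ := hu.integral_lowerDensity_le hψ
  have hp := hu.integrable_max_mul_sq hψ.memLp
  -- Finiteness of the negative potential energy is a consequence of the energy inequality: the
  -- integrable lower density dominates it.
  have hn : Integrable fun x => max (-(f x / u x)) 0 * ψ x ^ 2 := by
    refine h1.mono' ((hu.aestronglyMeasurable_div.neg.sup aestronglyMeasurable_const).mul
      (hψ.memLp.1.pow 2)) (Eventually.of_forall fun x => ?_)
    rw [Real.norm_of_nonneg (mul_nonneg (le_max_right _ _) (sq_nonneg _))]
    exact le_add_of_nonneg_left (Finset.sum_nonneg fun _ _ => sq_nonneg _)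
  have hw : ∀ x, f x / u x * ψ x ^ 2
      = max (f x / u x) 0 * ψ x ^ 2 - max (-(f x / u x)) 0 * ψ x ^ 2 := fun x => by
    rw [← sub_mul, max_zero_sub_eq_self]
  have hd : ∀ x, ∑ i, (G i x - ψ x * (g i x / u x)) ^ 2
      = lowerDensity u g f ψ G x - max (-(f x / u x)) 0 * ψ x ^ 2 := fun x => by
    rw [lowerDensity]; ring
  simp only [hw, hd]
  refine ⟨hp.sub hn, h1.sub hn, ?_⟩
  rw [integral_sub h1 hn, integral_sub hp hn]
  have h3 : ∫ x, upperDensity u f ψ G x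
      = (∫ x, ∑ i, G i x ^ 2) + ∫ x, max (f x / u x) 0 * ψ x ^ 2 :=
    integral_add (integrable_sum_sq hψ.memLp_grad) hp
  linarith

/-- The defect has nonnegative integrand and integral at most 0, so `∇ψ = ψ ∇u / u` almost
everywhere. -/
lemma IsPositiveProfile.exists_ae_eq_const_mul_of_le {u f ψ : R3 → ℝ} {g G : Fin 3 → R3 → ℝ}
    {C : ℝ} (hu : IsPositiveProfile u g f C) (hψ : HasL2Gradient ψ G)
    (h : (∫ x, ∑ i, G i x ^ 2) + (∫ x, f x / u x * ψ x ^ 2) ≤ 0) :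
    ∃ c : ℝ, ∀ᵐ x, ψ x = c * u x := by
  obtain ⟨-, h1, h2⟩ := hu.integral_defect_le hψ
  refine hu.exists_ae_eq_const_mul hψ ?_
  have h0 : ∀ x, 0 ≤ ∑ i, (G i x - ψ x * (g i x / u x)) ^ 2 := fun x =>
    Finset.sum_nonneg fun _ _ => sq_nonneg _
  have h3 := (integral_eq_zero_iff_of_nonneg h0 h1).1
    (le_antisymm (h2.trans h) (integral_nonneg h0))
  filter_upwards [h3] with x hx i
  have h4 := (Finset.sum_eq_zero_iff_of_nonneg fun i _ => sq_nonneg _).1 hx i (Finset.mem_univ i)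
  exact sub_eq_zero.1 (pow_eq_zero_iff two_ne_zero |>.1 h4)

/-! ### Weak gradients of complex wave functions -/

lemma locallyIntegrable_coord {g : R3 → EuclideanSpace ℂ (Fin 3)} (hg : LocallyIntegrable g)
    (i : Fin 3) : LocallyIntegrable fun x => g x i := by
  refine hg.mono ?_ (Eventually.of_forall fun x => PiLp.norm_apply_le _ i)
  have hi := (EuclideanSpace.proj i : EuclideanSpace ℂ (Fin 3) →L[ℂ] ℂ).continuous
  exact hi.comp_aestronglyMeasurable hg.aestronglyMeasurable

/-- The fundamental lemma of the calculus of variations in each coordinate. Since `weakGrad` is an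
arbitrary choice, this is what makes it square integrable on `H¹`. -/
lemma HasWeakGradient.ae_eq {ψ : R3 → ℂ} {g h : R3 → EuclideanSpace ℂ (Fin 3)}
    (hg : HasWeakGradient ψ g) (hh : HasWeakGradient ψ h) : g =ᵐ[volume] h := by
  have hi : ∀ i, ∀ᵐ x, g x i = h x i := fun i => by
    refine ae_eq_of_integral_contDiff_smul_eq
      (locallyIntegrable_coord hg.locallyIntegrable_grad i)
      (locallyIntegrable_coord hh.locallyIntegrable_grad i) fun η hη hηs => ?_
    have h1 := hg.integral_eq η ⟨hη, hηs⟩ i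
    have h2 := hh.integral_eq η ⟨hη, hηs⟩ i
    exact neg_injective (h1.symm.trans h2)
  filter_upwards [ae_all_iff.2 hi] with x hx
  ext i
  exact hx i

lemma MemH1.hasWeakGradient {ψ : R3 → ℂ} (hψ : MemH1 ψ) : HasWeakGradient ψ (weakGrad ψ) := by
  obtain ⟨-, g, hg, -⟩ := hψ
  have h : ∃ g, HasWeakGradient ψ g := ⟨g, hg⟩
  rw [weakGrad, dif_pos h]
  exact h.choose_spec

lemma MemH1.memLp_weakGrad {ψ : R3 → ℂ} (hψ : MemH1 ψ) : MemLp (weakGrad ψ) 2 := by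
  obtain ⟨-, g, hg, hg2⟩ := id hψ
  exact (memLp_congr_ae (hg.ae_eq hψ.hasWeakGradient)).1 hg2

lemma integrable_test_smul {η : R3 → ℝ} (hη : IsTest η) {ψ : R3 → ℂ} (hψ : LocallyIntegrable ψ) :
    Integrable fun x => η x • ψ x :=
  hψ.integrable_smul_left_of_hasCompactSupport hη.1.continuous hη.2

lemma integrable_test_mul {η : R3 → ℝ} (hη : IsTest η) {u : R3 → ℝ} (hu : LocallyIntegrable u) :
    Integrable fun x => η x * u x :=
  hu.integrable_smul_left_of_hasCompactSupport hη.1.continuous hη.2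

lemma integral_test_mul_clm {η : R3 → ℝ} (hη : IsTest η) {ψ : R3 → ℂ} (hψ : LocallyIntegrable ψ)
    (L : ℂ →L[ℝ] ℝ) : ∫ x, η x * L (ψ x) = L (∫ x, η x • ψ x) := by
  rw [← L.integral_comp_comm (integrable_test_smul hη hψ)]
  exact integral_congr_ae (Eventually.of_forall fun x => (L.map_smul (η x) (ψ x)).symm)

/-- Real and imaginary parts of an `H¹` function have weak gradients. -/
lemma MemH1.hasL2Gradient {ψ : R3 → ℂ} (hψ : MemH1 ψ) (L : ℂ →L[ℝ] ℝ) :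
    HasL2Gradient (fun x => L (ψ x)) fun i x => L (weakGrad ψ x i) := by
  have hg := hψ.hasWeakGradient
  have hgi : ∀ i, MemLp (fun x => weakGrad ψ x i) 2 := fun i => by
    refine hψ.memLp_weakGrad.mono ?_ (Eventually.of_forall fun x => PiLp.norm_apply_le _ i)
    exact (locallyIntegrable_coord hg.locallyIntegrable_grad i).aestronglyMeasurable
  have h1 : MemLp (fun x => L (ψ x)) 2 := L.comp_memLp' hψ.1
  have h2 : ∀ i, MemLp (fun x => L (weakGrad ψ x i)) 2 := fun i => L.comp_memLp' (hgi i)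
  refine ⟨h1, h2, fun i =>
    ⟨h1.locallyIntegrable_two, (h2 i).locallyIntegrable_two, fun η hη => ?_⟩⟩
  rw [integral_test_mul_clm (hη.partialDeriv i) hg.locallyIntegrable,
    integral_test_mul_clm hη (locallyIntegrable_coord hg.locallyIntegrable_grad i),
    hg.integral_eq η hη i, map_neg]

lemma laplacian_eq_sum {η : R3 → ℝ} (hη : IsTest η) (x : R3) :
    (Δ η) x = ∑ i, partialDeriv i (partialDeriv i η) x := by
  rw [InnerProductSpace.laplacian_eq_iteratedFDeriv_orthonormalBasis η
    (EuclideanSpace.basisFun (Fin 3) ℝ)]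
  refine Finset.sum_congr rfl fun i _ => ?_
  have hd : HasFDerivAt (fderiv ℝ η) (fderiv ℝ (fderiv ℝ η) x) x :=
    (((hη.1.fderiv_right (m := ∞) (by simp)).differentiable (by simp)) x).hasFDerivAt
  have h2 : HasFDerivAt (partialDeriv i η) _ x :=
    hd.clm_apply (hasFDerivAt_const (EuclideanSpace.single i (1 : ℝ)) x)
  rw [iteratedFDeriv_two_apply, partialDeriv, h2.fderiv]
  simp

/-- The weak partial derivatives of `u` are tested against `∂ᵢ η`, and summing over `i` produces `Δ
η`. -/
lemma HasL2Gradient.hasWeakDivergence {u T : R3 → ℝ} {g : Fin 3 → R3 → ℝ}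
    (hu : HasL2Gradient u g) (hT : LocallyIntegrable T)
    (h : ∀ η, IsTest η → ∫ x, (Δ η) x * u x = ∫ x, η x * T x) : HasWeakDivergence g T := by
  refine ⟨fun i => (hu.memLp_grad i).locallyIntegrable_two, hT, fun η hη => ?_⟩
  have h1 := fun i => (hu.hasWeakPartial i).integral_eq _ (hη.partialDeriv i)
  rw [← h η hη]
  simp only [laplacian_eq_sum hη, Finset.sum_mul]
  rw [integral_finsetSum _ fun i _ => integrable_test_mul ((hη.partialDeriv i).partialDeriv i)
    hu.memLp.locallyIntegrable_two]
  simp [h1]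

/-! ### The energy of complex wave functions -/

/-- The energy form `∫ |∇(Lψ)|² + ∫ w (Lψ)²` of a real part of `ψ`. -/
def energyForm (w : R3 → ℝ) (ψ : R3 → ℂ) (L : ℂ →L[ℝ] ℝ) : ℝ :=
  (∫ x, ∑ i, L (weakGrad ψ x i) ^ 2) + ∫ x, w x * L (ψ x) ^ 2

lemma norm_sq_eq_re_add_im (z : ℂ) : ‖z‖ ^ 2 = Complex.reCLM z ^ 2 + Complex.imCLM z ^ 2 := by
  rw [Complex.sq_norm, Complex.normSq_apply]
  simp only [Complex.reCLM_apply, Complex.imCLM_apply]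
  ring

lemma kinetic_eq {ψ : R3 → ℂ} (hψ : MemH1 ψ) :
    kinetic ψ = ENNReal.ofReal ((∫ x, ∑ i, Complex.reCLM (weakGrad ψ x i) ^ 2)
      + ∫ x, ∑ i, Complex.imCLM (weakGrad ψ x i) ^ 2) := by
  have hr := integrable_sum_sq (hψ.hasL2Gradient Complex.reCLM).memLp_grad
  have hi := integrable_sum_sq (hψ.hasL2Gradient Complex.imCLM).memLp_grad
  have e : ∀ x, ‖weakGrad ψ x‖ ^ 2 = (∑ i, Complex.reCLM (weakGrad ψ x i) ^ 2)
      + ∑ i, Complex.imCLM (weakGrad ψ x i) ^ 2 := fun x => by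
    rw [EuclideanSpace.norm_sq_eq, ← Finset.sum_add_distrib]
    exact Finset.sum_congr rfl fun i _ => norm_sq_eq_re_add_im _
  have hri : Integrable fun x => (∑ i, Complex.reCLM (weakGrad ψ x i) ^ 2)
      + ∑ i, Complex.imCLM (weakGrad ψ x i) ^ 2 := hr.add hi
  rw [← integral_add hr hi, ofReal_integral_eq_lintegral_ofReal hri
    (Eventually.of_forall fun x => add_nonneg (Finset.sum_nonneg fun _ _ => sq_nonneg _)
      (Finset.sum_nonneg fun _ _ => sq_nonneg _)), kinetic]
  refine lintegral_congr fun x => ?_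
  rw [← e, ENNReal.ofReal_pow (norm_nonneg _), ofReal_norm]

lemma ofReal_mul_enorm_sq (r : ℝ) (z : ℂ) :
    ENNReal.ofReal r * ‖z‖ₑ ^ 2 = ENNReal.ofReal (r * ‖z‖ ^ 2) := by
  rw [ENNReal.ofReal_mul' (sq_nonneg _), ENNReal.ofReal_pow (norm_nonneg _), ofReal_norm]

/-- The energy is real as soon as the potential energy is absolutely convergent. -/
lemma energy_eq_coe {v : R3 → ℝ} {ψ : R3 → ℂ} (hψ : MemH1 ψ)
    (hv : Integrable fun x => v x * ‖ψ x‖ ^ 2) :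
    potentialPos v ψ ≠ ⊤ ∧
    energy v ψ = (((∫ x, ∑ i, Complex.reCLM (weakGrad ψ x i) ^ 2)
      + (∫ x, ∑ i, Complex.imCLM (weakGrad ψ x i) ^ 2)
      + ∫ x, v x * ‖ψ x‖ ^ 2 : ℝ) : EReal) := by
  have hp : potentialPos v ψ = ∫⁻ x, ENNReal.ofReal (v x * ‖ψ x‖ ^ 2) :=
    lintegral_congr fun x => ofReal_mul_enorm_sq _ _
  have hn : potentialNeg v ψ = ∫⁻ x, ENNReal.ofReal (-(v x * ‖ψ x‖ ^ 2)) :=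
    lintegral_congr fun x => by rw [ofReal_mul_enorm_sq, neg_mul]
  have hpf : potentialPos v ψ ≠ ⊤ := hp ▸ hv.lintegral_lt_top.ne
  have hnf : potentialNeg v ψ ≠ ⊤ := hn ▸ hv.neg.lintegral_lt_top.ne
  refine ⟨hpf, ?_⟩
  have hint := integral_eq_lintegral_pos_part_sub_lintegral_neg_part hv
  rw [← hp, ← hn] at hint
  have h0 : 0 ≤ (∫ x, ∑ i, Complex.reCLM (weakGrad ψ x i) ^ 2)
      + ∫ x, ∑ i, Complex.imCLM (weakGrad ψ x i) ^ 2 :=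
    add_nonneg (integral_nonneg fun x => Finset.sum_nonneg fun _ _ => sq_nonneg _)
      (integral_nonneg fun x => Finset.sum_nonneg fun _ _ => sq_nonneg _)
  rw [energy, kinetic_eq hψ, hint, EReal.coe_ennreal_ofReal, max_eq_left h0,
    ← EReal.coe_toReal (x := (potentialPos v ψ : EReal)) (by simpa using hpf) (by simp),
    ← EReal.coe_toReal (x := (potentialNeg v ψ : EReal)) (by simpa using hnf) (by simp),
    ← EReal.coe_sub, ← EReal.coe_add, EReal.toReal_coe_ennreal, EReal.toReal_coe_ennreal]

lemma integral_mul_norm_sq {w : R3 → ℝ} {ψ : R3 → ℂ}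
    (hr : Integrable fun x => w x * Complex.reCLM (ψ x) ^ 2)
    (hi : Integrable fun x => w x * Complex.imCLM (ψ x) ^ 2) :
    Integrable (fun x => w x * ‖ψ x‖ ^ 2) ∧
    ∫ x, w x * ‖ψ x‖ ^ 2
      = (∫ x, w x * Complex.reCLM (ψ x) ^ 2) + ∫ x, w x * Complex.imCLM (ψ x) ^ 2 := by
  simp only [norm_sq_eq_re_add_im, mul_add]
  exact ⟨hr.add hi, integral_add hr hi⟩

/-- Every state in `W₁` has absolutely convergent potential energy, by the energy inequality for its
real and imaginary parts. The constant `e` is weighted by `∫ |ψ|² = 1`. -/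
lemma IsPositiveProfile.energy_eq {u f v : R3 → ℝ} {g : Fin 3 → R3 → ℝ} {C e : ℝ}
    (hu : IsPositiveProfile u g f C) (hv : ∀ᵐ x, v x = f x / u x + e) {ψ : R3 → ℂ}
    (hψ : MemW ψ) :
    HasEnergy v ψ ∧ Integrable (fun x => v x * ‖ψ x‖ ^ 2) ∧
    energy v ψ = ((energyForm (fun x => f x / u x) ψ Complex.reCLM
      + energyForm (fun x => f x / u x) ψ Complex.imCLM + e : ℝ) : EReal) := by
  obtain ⟨hr, -, -⟩ := hu.integral_defect_le (hψ.1.hasL2Gradient Complex.reCLM)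
  obtain ⟨hi, -, -⟩ := hu.integral_defect_le (hψ.1.hasL2Gradient Complex.imCLM)
  obtain ⟨hw, hwe⟩ := integral_mul_norm_sq hr hi
  have h2 : Integrable fun x => ‖ψ x‖ ^ 2 := hψ.1.1.norm.integrable_sq
  have hae : (fun x => f x / u x * ‖ψ x‖ ^ 2 + e * ‖ψ x‖ ^ 2)
      =ᵐ[volume] fun x => v x * ‖ψ x‖ ^ 2 := by
    filter_upwards [hv] with x hx
    rw [hx]; ring
  have hvi : Integrable fun x => v x * ‖ψ x‖ ^ 2 := (hw.add (h2.const_mul e)).congr hae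
  obtain ⟨hpf, hE⟩ := energy_eq_coe hψ.1 hvi
  refine ⟨⟨hψ, Or.inl hpf⟩, hvi, ?_⟩
  rw [hE, ← integral_congr_ae hae, integral_add hw (h2.const_mul e), integral_const_mul, hψ.2, hwe]
  simp only [energyForm]
  congr 1
  ring

lemma IsPositiveProfile.energyForm_nonneg {u f : R3 → ℝ} {g : Fin 3 → R3 → ℝ} {C : ℝ}
    (hu : IsPositiveProfile u g f C) {ψ : R3 → ℂ} (hψ : MemH1 ψ) (L : ℂ →L[ℝ] ℝ) :
    0 ≤ energyForm (fun x => f x / u x) ψ L :=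
  (integral_nonneg fun _ => Finset.sum_nonneg fun _ _ => sq_nonneg _).trans
    (hu.integral_defect_le (hψ.hasL2Gradient L)).2.2

lemma IsPositiveProfile.exists_ae_eq_of_energyForm_eq_zero {u f : R3 → ℝ} {g : Fin 3 → R3 → ℝ}
    {C : ℝ} (hu : IsPositiveProfile u g f C) {ψ : R3 → ℂ} (hψ : MemH1 ψ)
    (hr : energyForm (fun x => f x / u x) ψ Complex.reCLM = 0)
    (hi : energyForm (fun x => f x / u x) ψ Complex.imCLM = 0) :
    ∃ c : ℂ, ψ =ᵐ[volume] fun x => c * toC u x := by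
  obtain ⟨a, ha⟩ := hu.exists_ae_eq_const_mul_of_le (hψ.hasL2Gradient Complex.reCLM) hr.le
  obtain ⟨b, hb⟩ := hu.exists_ae_eq_const_mul_of_le (hψ.hasL2Gradient Complex.imCLM) hi.le
  refine ⟨⟨a, b⟩, ?_⟩
  filter_upwards [ha, hb] with x h1 h2
  apply Complex.ext
  · simpa [toC] using h1
  · simpa [toC] using h2

/-- The energy form vanishes on eigenfunctions. -/
lemma IsEigenfunction.energyForm_eq_zero {w v : R3 → ℝ} {e : ℝ} {φ : R3 → ℂ}
    (hφ : IsEigenfunction v e φ) (hv : ∀ᵐ x, v x = w x + e) {L : ℂ →L[ℝ] ℝ}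
    (hL : ∀ z, |L z| ≤ ‖z‖) : energyForm w φ L = 0 := by
  have hH := hφ.memH1.hasL2Gradient L
  have hφl := hφ.memH1.hasWeakGradient.locallyIntegrable
  have hvL : LocallyIntegrable fun x => v x * L (φ x) := by
    refine hφ.locallyIntegrable.mono ?_ (Eventually.of_forall fun x => ?_)
    · refine (L.continuous.comp_aestronglyMeasurable
        hφ.locallyIntegrable.aestronglyMeasurable).congr (Eventually.of_forall fun x => ?_)
      exact L.map_smul (v x) (φ x)
    · rw [norm_mul, norm_smul]
      exact mul_le_mul_of_nonneg_left (hL _) (norm_nonneg _)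
  have heL : LocallyIntegrable fun x => e * L (φ x) :=
    hH.memLp.locallyIntegrable_two.const_mul' e
  -- The equation says that this function is the weak Laplacian of `L φ`. Its product with `L φ` is
  -- integrable since `v |φ|²` is, so the equation may be tested against `L φ` itself.
  have hT : LocallyIntegrable fun x => v x * L (φ x) - e * L (φ x) := hvL.sub heL
  have hdiv := hH.hasWeakDivergence hT fun η hη => by
    have h1 := congrArg L (hφ.integral_eq η hη)
    have hΔ : IsTest (Δ η) := by
      have : Δ η = fun x => ∑ i, partialDeriv i (partialDeriv i η) x :=
        funext fun x => laplacian_eq_sum hη x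
      rw [this]
      refine ⟨ContDiff.sum fun i _ => ((hη.partialDeriv i).partialDeriv i).1, ?_⟩
      simp only [Fin.sum_univ_three]
      exact ((((hη.partialDeriv 0).partialDeriv 0).2.add
        ((hη.partialDeriv 1).partialDeriv 1).2).add ((hη.partialDeriv 2).partialDeriv 2).2)
    rw [map_add, map_neg, map_smul, ← integral_test_mul_clm hΔ hφl,
      ← integral_test_mul_clm hη hφ.locallyIntegrable, ← integral_test_mul_clm hη hφl] at h1
    simp only [map_smul, smul_eq_mul] at h1
    simp only [mul_sub]
    rw [integral_sub (integrable_test_mul hη hvL) (integrable_test_mul hη heL)]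
    simp only [mul_left_comm _ e, integral_const_mul]
    linarith
  have hae : (fun x => (v x * L (φ x) - e * L (φ x)) * L (φ x))
      =ᵐ[volume] fun x => w x * L (φ x) ^ 2 := by
    filter_upwards [hv] with x hx
    rw [hx]; ring
  have hi : Integrable fun x => (v x * L (φ x) - e * L (φ x)) * L (φ x) := by
    have h2 := hφ.memH1.1.norm.integrable_sq
    refine (hφ.integrable_potential.norm.add (h2.const_mul |e|)).mono'
      (hT.aestronglyMeasurable.mul hH.memLp.1) (Eventually.of_forall fun x => ?_)
    have h3 : L (φ x) ^ 2 ≤ ‖φ x‖ ^ 2 := by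
      rw [← sq_abs]
      exact pow_le_pow_left₀ (abs_nonneg _) (hL _) 2
    have h4 : (v x * L (φ x) - e * L (φ x)) * L (φ x)
        = v x * L (φ x) ^ 2 - e * L (φ x) ^ 2 := by ring
    rw [h4]
    refine (norm_sub_le _ _).trans (add_le_add ?_ ?_)
    · dsimp only
      rw [norm_mul, norm_mul, Real.norm_of_nonneg (sq_nonneg (L (φ x))),
        Real.norm_of_nonneg (sq_nonneg ‖φ x‖)]
      exact mul_le_mul_of_nonneg_left h3 (norm_nonneg _)
    · rw [norm_mul, Real.norm_of_nonneg (sq_nonneg (L (φ x))), Real.norm_eq_abs]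
      exact mul_le_mul_of_nonneg_left h3 (abs_nonneg _)
  have key := hH.integral_grad_sq_eq hdiv hi
  rw [energyForm, key, integral_congr_ae hae]
  ring

/-! ### The ground state -/

/-- Positivity gives `v u = f + e u` almost everywhere, and the equation becomes the definition of
the weak Laplacian. -/
lemma isEigenfunction_toC {u f v : R3 → ℝ} {e : ℝ} (hu : MemH1 (toC u)) (hpos : ∀ᵐ x, 0 < u x)
    (hΔ : HasWeakLaplacian u f) (hv : ∀ᵐ x, v x = f x / u x + e)
    (hi : Integrable fun x => v x * ‖toC u x‖ ^ 2) : IsEigenfunction v e (toC u) := by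
  have hvu : (fun x => f x + e * u x) =ᵐ[volume] fun x => v x * u x := by
    filter_upwards [hpos, hv] with x h1 h2
    rw [h2]; field_simp
  have hul := hΔ.locallyIntegrable
  have hfl := hΔ.locallyIntegrable_laplacian
  have hle : LocallyIntegrable fun x => f x + e * u x := hfl.add (hul.const_mul' e)
  have hvul : LocallyIntegrable fun x => v x * u x := by
    refine hle.mono (hle.aestronglyMeasurable.congr hvu) ?_
    filter_upwards [hvu] with x hx
    rw [hx]
  refine ⟨hu, hi, ?_, fun η hη => ?_⟩
  · refine hvul.mono ?_ (Eventually.of_forall fun x => by simp [toC])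
    refine (Complex.continuous_ofReal.comp_aestronglyMeasurable
      hvul.aestronglyMeasurable).congr (Eventually.of_forall fun x => ?_)
    simp [toC]
  · have e1 : ∀ η : R3 → ℝ, ∫ x, η x • toC u x = ((∫ x, η x * u x : ℝ) : ℂ) := fun η => by
      rw [← integral_complex_ofReal]
      simp [toC]
    have e2 : ∫ x, η x • (v x • toC u x) = ((∫ x, η x * (v x * u x) : ℝ) : ℂ) := by
      rw [← integral_complex_ofReal]
      simp [toC]
    have e3 : ∫ x, η x * (v x * u x) = (∫ x, η x * f x) + e * ∫ x, η x * u x := by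
      rw [← integral_const_mul, ← integral_add (integrable_test_mul hη hfl)
        ((integrable_test_mul hη hul).const_mul e)]
      refine integral_congr_ae ?_
      filter_upwards [hvu] with x hx
      rw [← hx]; ring
    rw [e1, e1, e2, e3, hΔ.integral_eq η hη]
    simp

/-- A positive `H¹` function `u` with `Δu ∈ L²`, `Δu ≤ C u` and `u⁻²` locally integrable is the
ground state of `-Δ + Δu / u + e`. -/
theorem isGroundState_toC {u f v : R3 → ℝ} {C e : ℝ} (hW : MemW (toC u)) (hpos : ∀ᵐ x, 0 < u x)
    (hΔ : HasWeakLaplacian u f) (hf : MemLp f 2) (hle : ∀ᵐ x, f x ≤ C * u x)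
    (hinv : LocallyIntegrable fun x => (u x ^ 2)⁻¹) (hv : ∀ᵐ x, v x = f x / u x + e) :
    IsGroundState v e (toC u) := by
  have hg : HasL2Gradient u fun i x => Complex.reCLM (weakGrad (toC u) x i) :=
    hW.1.hasL2Gradient Complex.reCLM
  have hu : IsPositiveProfile u (fun i x => Complex.reCLM (weakGrad (toC u) x i)) f |C| :=
    { hasL2Gradient := hg
      hasWeakDivergence := hg.hasWeakDivergence hΔ.locallyIntegrable_laplacian hΔ.integral_eq
      pos := hpos
      memLp := hf
      nonneg_const := abs_nonneg C
      le_const_mul := by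
        filter_upwards [hle, hpos] with x h1 h2
        exact h1.trans (mul_le_mul_of_nonneg_right (le_abs_self C) h2.le)
      locallyIntegrable_inv_sq := hinv }
  have hzero : ∀ φ, IsEigenfunction v e φ →
      energyForm (fun x => f x / u x) φ Complex.reCLM = 0 ∧
      energyForm (fun x => f x / u x) φ Complex.imCLM = 0 := fun φ hφ =>
    ⟨hφ.energyForm_eq_zero hv fun z => Complex.abs_re_le_norm z,
      hφ.energyForm_eq_zero hv fun z => Complex.abs_im_le_norm z⟩
  obtain ⟨hE, hi, hEeq⟩ := hu.energy_eq hv hW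
  have heig := isEigenfunction_toC hW.1 hpos hΔ hv hi
  -- No separate integration by parts for `u` is needed: it is an eigenfunction, so its energy forms
  -- vanish.
  have huE : energy v (toC u) = (e : EReal) := by
    rw [hEeq, (hzero _ heig).1, (hzero _ heig).2]
    simp
  have hground : groundEnergy v = (e : EReal) := by
    refine le_antisymm ((iInf₂_le (toC u) hE).trans huE.le) (le_iInf₂ fun ψ hψ => ?_)
    rw [(hu.energy_eq hv hψ.1).2.2, EReal.coe_le_coe_iff]
    linarith [hu.energyForm_nonneg hψ.1.1 Complex.reCLM,
      hu.energyForm_nonneg hψ.1.1 Complex.imCLM]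
  refine ⟨?_, hW, hground, hE, huE.trans hground.symm, heig, fun φ hφ => ?_, fun φ hφ hφE => ?_⟩
  · have h1 : LocallyIntegrable fun x => f x / u x + e :=
      (hu.locallyIntegrable_div hf).add (locallyIntegrable_const e)
    refine h1.mono (h1.aestronglyMeasurable.congr (hv.mono fun x hx => hx.symm)) ?_
    filter_upwards [hv] with x hx
    rw [hx]
  · exact hu.exists_ae_eq_of_energyForm_eq_zero hφ.memH1 (hzero φ hφ).1 (hzero φ hφ).2
  · rw [(hu.energy_eq hv hφ.1).2.2, hground, EReal.coe_eq_coe_iff] at hφE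
    have h1 := hu.energyForm_nonneg hφ.1.1 Complex.reCLM
    have h2 := hu.energyForm_nonneg hφ.1.1 Complex.imCLM
    exact hu.exists_ae_eq_of_energyForm_eq_zero hφ.1.1 (by linarith) (by linarith)

end OneElectron

end

theorem corollary1 :
    (∀ (ρ ψ₀ φ₀ : OneElectron.R3 → ℝ) (C : ℝ),
      OneElectron.MemI ρ →
      OneElectron.IsMinimizer ρ ψ₀ →
      (∀ᵐ x, ψ₀ x ≠ 0) →
      OneElectron.HasWeakLaplacian ψ₀ φ₀ →
      MemLp φ₀ 2 →
      (∀ᵐ x, φ₀ x ≤ C * √(ρ x)) →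
      LocallyIntegrable (fun x => (ρ x)⁻¹) →
      (∀ᵐ x, ψ₀ x = √(ρ x)) ∧
      ∀ e : ℝ, OneElectron.IsGroundState (fun x => φ₀ x / √(ρ x) + e) e
        (OneElectron.toC ψ₀)) ∧
    (∀ (ρ φ₀ : OneElectron.R3 → ℝ) (C : ℝ),
      OneElectron.MemI ρ →
      (∀ᵐ x, 0 < ρ x) →
      OneElectron.HasWeakLaplacian (fun x => √(ρ x)) φ₀ →
      MemLp φ₀ 2 →
      (∀ᵐ x, φ₀ x ≤ C * √(ρ x)) →
      LocallyIntegrable (fun x => (ρ x)⁻¹) →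
      OneElectron.IsVRepresentable ρ) := by
  have hcongr : ∀ {a b : OneElectron.R3 → ℝ}, LocallyIntegrable a → (∀ᵐ x, a x = b x) →
      LocallyIntegrable b := by
    intro a b ha h
    refine ha.mono (ha.aestronglyMeasurable.congr h) ?_
    filter_upwards [h] with x hx
    rw [hx]
  refine ⟨fun ρ ψ₀ φ₀ C _ hmin hne hΔ hφ hle hinv => ?_, fun ρ φ₀ C hρ hpos hΔ hφ hle hinv => ?_⟩
  -- The constraints `ψ₀ ≥ 0` and `ψ₀² = ρ` already determine `ψ₀` up to a null set.
  · have hsqrt : ∀ᵐ x, ψ₀ x = √(ρ x) := by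
      filter_upwards [hmin.1.nonneg, hmin.1.sq_eq] with x h1 h2
      rw [← h2, Real.sqrt_sq h1]
    refine ⟨hsqrt, fun e => OneElectron.isGroundState_toC (C := C) hmin.1.memW ?_ hΔ hφ ?_ ?_ ?_⟩
    · filter_upwards [hmin.1.nonneg, hne] with x h1 h2 using lt_of_le_of_ne h1 h2.symm
    · filter_upwards [hle, hsqrt] with x h1 h2
      rwa [h2]
    · refine hcongr hinv ?_
      filter_upwards [hmin.1.sq_eq] with x hx
      rw [hx]
    · filter_upwards [hsqrt] with x hx
      rw [hx]
  · have hsq : ∀ᵐ x, √(ρ x) ^ 2 = ρ x := hρ.nonneg.mono fun x hx => Real.sq_sqrt hx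
    have hnorm : ∀ x, ‖OneElectron.toC (fun x => √(ρ x)) x‖ ^ 2 = √(ρ x) ^ 2 := fun x => by
      simp [OneElectron.toC]
    -- The energy normalization is arbitrary; `e = 0` is chosen.
    refine ⟨fun x => φ₀ x / √(ρ x) + 0, 0, OneElectron.toC fun x => √(ρ x),
      OneElectron.isGroundState_toC (C := C) ⟨hρ.sqrt_memH1, ?_⟩ ?_ hΔ hφ hle ?_ ?_, ?_⟩
    · simp only [hnorm]
      rw [integral_congr_ae hsq, hρ.integral_eq_one]
    · exact hpos.mono fun x hx => Real.sqrt_pos.2 hx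
    · exact hcongr hinv (hsq.mono fun x hx => by rw [hx])
    · exact Filter.Eventually.of_forall fun x => rfl
    · exact hsq.mono fun x hx => by rw [hnorm, hx]
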